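/- **Conventions.** All graphs are finite and simple. Rank, independence, circuits and closure refer to one fixed choice of matroid: either the 3-dimensional generic rigidity matroid $\mathcal R_3$ or Whiteley's generic cofactor matroid $\mathcal M_{K_5}$, on the pairs of distinct vertices of the graph at hand. A graph is independent if its edge set is; a subgraph is rigid if the closure of its edge set contains all pairs of its vertices; a graph is *nucleation-free* if it has no rigid subgraph on at least five vertices; a nonedge $f$ of $G$ is *implied* if $G\cup f$ contains a circuit that includes $f$. **Covers.** A *2-thin cover* of $G$ is a set $\mathcal X$ of subsets (clusters) of $V(G)$ with $|X|\ge 2$ for all $X\in\mathcal X$, $|X\cap Y|\le 2$ and $X\not\subset Y$ for all distinct $X,Y\in\mathcal X$, such that each edge of $G$ lies in some cluster. Its *shared set* $S(\mathcal X)$ consists of all pairs $\{u,v\}$, $u\ne v$, of the form $X\cap Y$ with $X\ne Y$ in $\mathcal X$; $\mathcal X$ is *independent* if $S(\mathcal X)$ is. For a set $S$ of pairs let $d(\mathcal X,e)$ be the number of clusters containing $e$, let $G_S$ be $G$ with the pairs in $S$ added as edges, and put $$IE_S(G,\mathcal X)=\sum_{X\in\mathcal X}\operatorname{rank}(G_S[X])-\sum_{e\in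 S}(d(\mathcal X,e)-1),\qquad IE(G,\mathcal X)=IE_{S(\mathcal X)}(G,\mathcal X).$$ **Base graph and split.** Let $G$ be an independent graph with an independent 2-thin cover $\mathcal X$ such that $\operatorname{rank}(G)=IE(G,\mathcal X)$. Let $(a,b)$ be a nonedge of $G$ in $S(\mathcal X)$. Let $G^s$ be obtained by replacing $a$ by two vertices $a_1,a_2$ whose neighbourhoods partition that of $a$, and $b$ by two vertices $b_1,b_2$ whose neighbourhoods partition that of $b$ (parts may be empty). For $X\in\mathcal X$ let $X'$ be obtained from $X$ by replacing $a$, if $a\in X$, by those of $a_1,a_2$ that are adjacent in $G^s$ to a vertex in $X$, and replacing $b$, if $b\in X$, by those of $b_1,b_2$ that are adjacent in $G^s$ to a vertex in $X$. The split is *safe* if (i) whenever $X$ contains a nonedge of $G$ that belongs to $S(\mathcal X)$, neither $\{a_1,a_2\}$ nor $\{b_1,b_2\}$ is a subset of $X'$; and (ii) $X'\cap\{a_1,a_2\}=Y'\cap\{a_1,a_2\}$ whenever $X\cap Y=\{a,u\}$ with $u\neq b$ and $(a,u)$ a nonedge in $S(\mathcal X)$, and likewise with $a$ and $b$ interchanged.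 The *safe split cover* $\mathcal X^s$ of $G^s$ consists of all $X'$ with $|X'|>2$ that contain neither $\{a_1,a_2\}$ nor $\{b_1,b_2\}$, together with the endpoint pairs of all edges of $G^s$ not contained in one of these. The *key gluing pairs* of $G^s$ are the pairs of distinct vertices in $\{a_1,a_2,b_1,b_2\}$ contained in some cluster of $\mathcal X^s$. **Ear.** Let $H$ be a graph, vertex-disjoint from $G^s$, with a set $Q$ of gluing vertices, no two of which are adjacent in $H$, and with an independent 2-thin cover $\mathcal X^H$. Let $F_H$ be the set of *key gluing pairs* of $H$, i.e. pairs of distinct gluing vertices contained in some cluster of $\mathcal X^H$. Assume that (i) each cluster of $\mathcal X^H$ contains at most two gluing vertices; (ii) $S(\mathcal X^H)\cup F$ is independent, where $F$ is the set of all pairs of distinct gluing vertices; (iii) $\operatorname{rank}(H)=IE_{S(\mathcal X^H)\cup F_H}(H,\mathcal X^H)-1$. **Glue.** Let $P\subseteq\{a_1,a_2,b_1,b_2\}$ contain the endpoints of all key gluing pairs of $G^s$, and let $\varphi:Q\to P$ be a bijection that carries the key gluing pairs of $H$ exactly onto the key gluing pairs of $G^s$. Let $G^s{:}H$ be obtained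 from the disjoint union of $G^s$ and $H$ by identifying each $q\in Q$ with $\varphi(q)$. (This is the result of a *safe split-and-glue*.) **Corollary 3.8.** If $G^s{:}H$ is independent and both $G^s$ and $H$ are nucleation-free, then $G^s{:}H$ is nucleation-free and has an implied nonedge. -/

import Mathlib

namespace SplitGlue

/-! ### The matroids -/

/-- The two matroids on the pairs of vertices of a finite vertex set that are considered:
the 3-dimensional generic rigidity matroid, and Whiteley's generic (`C_2^1`) cofactor matroid
(the maximal matroid in which every `K_5` is a circuit). -/
inductive RigidityKind
  | generic
  | cofactor

/-- The dimension of the space in which the vertices are placed. -/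
def RigidityKind.dim : RigidityKind → ℕ
  | .generic => 3
  | .cofactor => 2

/-- `((x₀-y₀)², (x₀-y₀)(x₁-y₁), (x₁-y₁)²)`: the entries of a row of the cofactor matrix. -/
def cofactorVec {R : Type*} [CommRing R] (x y : Fin 2 → R) : Fin 3 → R :=
  ![(x 0 - y 0) ^ 2, (x 0 - y 0) * (x 1 - y 1), (x 1 - y 1) ^ 2]

/-- The vector in the columns of the first endpoint of a pair whose endpoints are placed at
`x` and `y`; its negative stands in the columns of the second endpoint. The base ring is a
parameter only so that polynomial placements can be used below; the matroid uses `ℝ`. -/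
def edgeVec {R : Type*} [CommRing R] :
    (κ : RigidityKind) → (Fin κ.dim → R) → (Fin κ.dim → R) → Fin 3 → R
  | .generic, x, y => fun i => x i - y i
  | .cofactor, x, y => cofactorVec x y

open Classical in
/-- The row of the rigidity (or cofactor) matrix of the placement `p` that belongs to the pair `e`:
with `e = uv` it is `edgeVec κ (p u) (p v)` in the three columns of `u`, the negative of this in
the three columns of `v`, and zero elsewhere. (`Quot.out` orders the endpoints; the other order
changes the row at most by a sign.) -/
noncomputable def rigidityRow {R : Type*} [CommRing R] {V : Type*} (κ : RigidityKind)
    (p : V → Fin κ.dim → R) (e : Sym2 V) : V × Fin 3 → R := fun wi =>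
  edgeVec κ (p (Quot.out e).1) (p (Quot.out e).2) wi.2 *
    ((if wi.1 = (Quot.out e).1 then 1 else 0) - (if wi.1 = (Quot.out e).2 then 1 else 0))

/-- A set of pairs is independent if for some placement of the vertices (equivalently, for every
generic one) its rows in the rigidity (or cofactor) matrix are linearly independent. -/
def RowIndep {V : Type*} (κ : RigidityKind) (I : Set (Sym2 V)) : Prop :=
  I ⊆ {e | ¬ e.IsDiag} ∧ ∃ p : V → Fin κ.dim → ℝ, LinearIndepOn ℝ (rigidityRow κ p) I

theorem edgeVec_map {R S : Type*} [CommRing R] [CommRing S] (f : R →+* S) (κ : RigidityKind)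
    (x y : Fin κ.dim → R) (i : Fin 3) :
    f (edgeVec κ x y i) = edgeVec κ (fun j => f (x j)) (fun j => f (y j)) i := by
  cases κ with
  | generic => simp [edgeVec]
  | cofactor => fin_cases i <;> simp [edgeVec, cofactorVec]

theorem rigidityRow_map {R S : Type*} [CommRing R] [CommRing S] (f : R →+* S) {V : Type*}
    (κ : RigidityKind) (p : V → Fin κ.dim → R) (e : Sym2 V) (w : V × Fin 3) :
    f (rigidityRow κ p e w) = rigidityRow κ (fun v j => f (p v j)) e w := by
  unfold rigidityRow
  rw [map_mul, edgeVec_map]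
  congr 1
  split_ifs <;> simp

theorem gram_det_ne_zero_iff {ι m : Type*} [Fintype ι] [DecidableEq ι] [Fintype m]
    (A : Matrix ι m ℝ) : (A * A.transpose).det ≠ 0 ↔ LinearIndependent ℝ A.row := by
  rw [← not_iff_not, not_not, ← Matrix.exists_vecMul_eq_zero_iff,
    ← Matrix.vecMul_injective_iff]
  constructor
  · rintro ⟨v, hv, h⟩ hi
    apply hv
    apply hi
    have h2 : Matrix.vecMul v A ⬝ᵥ Matrix.vecMul v A = 0 := by
      have := congrArg (fun z => z ⬝ᵥ v) h
      simp only [← Matrix.vecMul_vecMul, Matrix.vecMul_transpose, zero_dotProduct] at this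
      rw [← this, ← Matrix.dotProduct_mulVec, dotProduct_comm] 
    simpa using dotProduct_self_eq_zero.1 h2
  · intro h
    rw [Function.not_injective_iff] at h
    obtain ⟨x, y, hxy, hne⟩ := h
    refine ⟨x - y, sub_ne_zero.2 hne, ?_⟩
    rw [← Matrix.vecMul_vecMul, Matrix.sub_vecMul]
    rw [hxy, sub_self, Matrix.zero_vecMul]

theorem exists_common_position {V : Type*} [Finite V] (κ : RigidityKind) {I J : Set (Sym2 V)}
    (hI : RowIndep κ I) (hJ : RowIndep κ J) :
    ∃ p : V → Fin κ.dim → ℝ,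
      LinearIndepOn ℝ (rigidityRow κ p) I ∧ LinearIndepOn ℝ (rigidityRow κ p) J := by
  classical
  have := Fintype.ofFinite V
  obtain ⟨-, p, hp⟩ := hI
  obtain ⟨-, q, hq⟩ := hJ
  let P : V → Fin κ.dim → Polynomial ℝ := fun v j =>
    Polynomial.C (p v j) + Polynomial.X * Polynomial.C (q v j - p v j)
  let A (K : Set (Sym2 V)) : Matrix K (V × Fin 3) (Polynomial ℝ) :=
    Matrix.of fun e w => rigidityRow κ P e.1 w
  let pt (t : ℝ) : V → Fin κ.dim → ℝ := fun v j => p v j + t * (q v j - p v j)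
  have key (K : Set (Sym2 V)) (t : ℝ) :
      ((A K * (A K).transpose).det).eval t ≠ 0 ↔ LinearIndepOn ℝ (rigidityRow κ (pt t)) K := by
    rw [← Polynomial.coe_evalRingHom, RingHom.map_det]
    have h1 : (A K).map (Polynomial.evalRingHom t) =
        (Matrix.of fun (e : K) w => rigidityRow κ (pt t) e.1 w) := by
      ext e w
      simp only [Matrix.map_apply, A, Matrix.of_apply]
      rw [rigidityRow_map]
      simp [P, pt]
    have h2 : (Polynomial.evalRingHom t).mapMatrix (A K * (A K).transpose) =
        (Matrix.of fun (e : K) w => rigidityRow κ (pt t) e.1 w) *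
        (Matrix.of fun (e : K) w => rigidityRow κ (pt t) e.1 w).transpose := by
      rw [← h1]
      simp only [RingHom.mapMatrix_apply]
      rw [Matrix.map_mul, Matrix.transpose_map]
    rw [h2, gram_det_ne_zero_iff]
    rfl
  have hp0 : pt 0 = p := by ext v j; simp [pt]
  have hq1 : pt 1 = q := by ext v j; simp [pt]
  have hI0 := (key I 0).2 (by rwa [hp0])
  have hJ1 := (key J 1).2 (by rwa [hq1])
  have hne : (A I * (A I).transpose).det * (A J * (A J).transpose).det ≠ 0 := by
    refine mul_ne_zero ?_ ?_
    · rintro h; simp [h] at hI0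
    · rintro h; simp [h] at hJ1
  obtain ⟨t, ht⟩ : ∃ t, ((A I * (A I).transpose).det * (A J * (A J).transpose).det).eval t ≠ 0 := by
    by_contra! h
    exact hne (Polynomial.funext (by simpa using h))
  rw [Polynomial.eval_mul] at ht
  exact ⟨pt t, (key I t).1 (left_ne_zero_of_mul ht), (key J t).1 (right_ne_zero_of_mul ht)⟩

theorem rowIndep_augment {V : Type*} [Finite V] (κ : RigidityKind) {I J : Set (Sym2 V)}
    (hI : RowIndep κ I) (hJ : RowIndep κ J) (hlt : I.ncard < J.ncard) :
    ∃ e ∈ J, e ∉ I ∧ RowIndep κ (insert e I) := by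
  obtain ⟨p, hpI, hpJ⟩ := exists_common_position κ hI hJ
  by_contra! h
  have hsub : rigidityRow κ p '' J ⊆ Submodule.span ℝ (rigidityRow κ p '' I) := by
    rintro _ ⟨e, he, rfl⟩
    by_contra hn
    have heI : e ∉ I := fun heI => hn (Submodule.subset_span ⟨e, heI, rfl⟩)
    refine h e he heI ⟨Set.insert_subset (hJ.1 he) hI.1, p, ?_⟩
    exact (linearIndepOn_insert heI).2 ⟨hpI, hn⟩
  have hfI : (rigidityRow κ p '' I).Finite := Set.toFinite _
  have h1 : Module.finrank ℝ (Submodule.span ℝ (rigidityRow κ p '' I)) ≤ I.ncard := by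
    have := Set.Finite.fintype hfI
    refine (finrank_span_le_card _).trans ?_
    rw [← Set.ncard_eq_toFinset_card']
    exact Set.ncard_image_le (Set.toFinite _)
  have h2 : Module.finrank ℝ (Submodule.span ℝ (rigidityRow κ p '' J)) = J.ncard := by
    have := Fintype.ofFinite J
    have h3 := finrank_span_eq_card (R := ℝ) hpJ
    rw [← Set.image_eq_range] at h3
    rw [h3, ← Nat.card_eq_fintype_card, Nat.card_coe_set_eq]
  have h3 := Submodule.finrank_mono (Submodule.span_le.2 hsub) (R := ℝ)
    (M := V × Fin 3 → ℝ)
  omega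

/-- The 3-dimensional generic rigidity matroid, respectively the generic cofactor matroid,
on the pairs of distinct elements of `V`. -/
noncomputable def rigidityMatroid (κ : RigidityKind) (V : Type*) [Finite V] : Matroid (Sym2 V) :=
  (IndepMatroid.ofFinite (E := {e : Sym2 V | ¬ e.IsDiag}) (Set.toFinite _) (RowIndep κ)
    ⟨Set.empty_subset _, 0, linearIndepOn_empty _ _⟩
    (fun _ _ hJ hIJ => ⟨hIJ.trans hJ.1, hJ.2.imp fun _ hp => hp.mono hIJ⟩)
    (fun _ _ => rowIndep_augment κ) (fun _ hI => hI.1)).matroid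

/-! ### Rigidity notions -/

/-- The pairs of distinct vertices in `X`. -/
def pairsIn {V : Type*} (X : Set V) : Set (Sym2 V) := {e | ¬ e.IsDiag ∧ ∀ v ∈ e, v ∈ X}

noncomputable def rk (κ : RigidityKind) {V : Type*} [Finite V] (F : Set (Sym2 V)) : ℕ :=
  ((rigidityMatroid κ V).eRk F).toNat

def IsIndependent (κ : RigidityKind) {V : Type*} [Finite V] (G : SimpleGraph V) : Prop :=
  (rigidityMatroid κ V).Indep G.edgeSet

/-- A subgraph is rigid if its edges span all pairs of its vertices. -/
def IsRigid (κ : RigidityKind) {V : Type*} [Finite V] {G : SimpleGraph V} (N : G.Subgraph) :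
    Prop :=
  pairsIn N.verts ⊆ (rigidityMatroid κ V).closure N.edgeSet

/-- No rigid subgraph has five or more vertices. -/
def NucleationFree (κ : RigidityKind) {V : Type*} [Finite V] (G : SimpleGraph V) : Prop :=
  ∀ N : G.Subgraph, 5 ≤ N.verts.ncard → ¬ IsRigid κ N

/-- `f` is a nonedge of `G`, and `G ∪ f` contains a circuit that includes `f`. -/
def IsImpliedNonedge (κ : RigidityKind) {V : Type*} [Finite V] (G : SimpleGraph V)
    (f : Sym2 V) : Prop :=
  ¬ f.IsDiag ∧ f ∉ G.edgeSet ∧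
    ∃ C, (rigidityMatroid κ V).IsCircuit C ∧ C ⊆ insert f G.edgeSet ∧ f ∈ C

/-! ### Thin covers and the inclusion-exclusion rank count -/

structure IsTwoThinCover {V : Type*} (G : SimpleGraph V) (𝒳 : Set (Set V)) : Prop where
  two_le : ∀ X ∈ 𝒳, 2 ≤ X.ncard
  inter_le : ∀ X ∈ 𝒳, ∀ Y ∈ 𝒳, X ≠ Y → (X ∩ Y).ncard ≤ 2
  not_subset : ∀ X ∈ 𝒳, ∀ Y ∈ 𝒳, X ≠ Y → ¬ X ⊆ Y
  covers : ∀ e ∈ G.edgeSet, ∃ X ∈ 𝒳, e ∈ pairsIn X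

/-- The shared set: all pairs that are the intersection of two distinct clusters. -/
def sharedSet {V : Type*} (𝒳 : Set (Set V)) : Set (Sym2 V) :=
  {e | ∃ u v, u ≠ v ∧ e = s(u, v) ∧ ∃ X ∈ 𝒳, ∃ Y ∈ 𝒳, X ≠ Y ∧ X ∩ Y = {u, v}}

/-- The number of clusters that contain the pair `e`. -/
noncomputable def coverDegree {V : Type*} (𝒳 : Set (Set V)) (e : Sym2 V) : ℕ :=
  {X ∈ 𝒳 | ∀ v ∈ e, v ∈ X}.ncard

/-- `∑_{X ∈ 𝒳} rank(G_S[X]) - ∑_{e ∈ S} (d(𝒳, e) - 1)`, where `G_S` is `G` with the pairs in `S`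
added as edges. -/
noncomputable def rankCount (κ : RigidityKind) {V : Type*} [Finite V] (G : SimpleGraph V)
    (𝒳 : Set (Set V)) (S : Set (Sym2 V)) : ℤ :=
  ∑ᶠ X ∈ 𝒳, (rk κ ((G.edgeSet ∪ S) ∩ pairsIn X) : ℤ) -
    ∑ᶠ e ∈ S, ((coverDegree 𝒳 e : ℤ) - 1)

/-- The pairs of distinct gluing vertices (elements of `Q`) that lie in some cluster. -/
def keyPairs {V : Type*} (𝒳 : Set (Set V)) (Q : Set V) : Set (Sym2 V) :=
  {e ∈ pairsIn Q | ∃ X ∈ 𝒳, e ∈ pairsIn X}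

/-! ### Nonedge-splits -/

/-- The vertices after splitting `a` and `b`: the old vertices other than `a` and `b`
(`Sum.inl`), two copies of `a`, and two copies of `b`. -/
abbrev SplitVertex {V : Type*} (a b : V) : Type _ :=
  {v : V // v ≠ a ∧ v ≠ b} ⊕ (Fin 2 ⊕ Fin 2)

abbrev copyA {V : Type*} {a b : V} (i : Fin 2) : SplitVertex a b := Sum.inr (Sum.inl i)

abbrev copyB {V : Type*} {a b : V} (i : Fin 2) : SplitVertex a b := Sum.inr (Sum.inr i)

def newVertices {V : Type*} (a b : V) : Set (SplitVertex a b) := Set.range Sum.inr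

/-- The vertex of the original graph that a vertex of the split graph comes from. -/
def collapse {V : Type*} {a b : V} : SplitVertex a b → V
  | Sum.inl v => v
  | Sum.inr (Sum.inl _) => a
  | Sum.inr (Sum.inr _) => b

/-- The neighbour `w` of `collapse x` is assigned to `x`. -/
def Assigned {V : Type*} {a b : V} (α β : V → Fin 2) : SplitVertex a b → V → Prop
  | Sum.inl _, _ => True
  | Sum.inr (Sum.inl i), w => α w = i
  | Sum.inr (Sum.inr i), w => β w = i

/-- The split graph: the neighbours `w` of `a` are distributed to the two copies of `a`
according to `α w`, and those of `b` to the two copies of `b` according to `β w`.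
It is used for nonadjacent `a ≠ b`. -/
def splitGraph {V : Type*} (G : SimpleGraph V) (a b : V) (α β : V → Fin 2) :
    SimpleGraph (SplitVertex a b) where
  Adj x y := G.Adj (collapse x) (collapse y) ∧
    Assigned α β x (collapse y) ∧ Assigned α β y (collapse x)
  symm := ⟨fun _ _ h => ⟨h.1.symm, h.2.2, h.2.1⟩⟩
  loopless := ⟨fun x h => G.loopless.irrefl (collapse x) h.1⟩

/-- The set `X'` obtained from a cluster `X`: replace `a`, if it lies in `X`, by those of its copies
that are adjacent in the split graph to some vertex in `X`, and the same for `b`. -/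
def splitCluster {V : Type*} (G : SimpleGraph V) (a b : V) (α β : V → Fin 2) (X : Set V) :
    Set (SplitVertex a b) :=
  {x | collapse x ∈ X ∧ (x ∈ newVertices a b →
    ∃ w : {v : V // v ≠ a ∧ v ≠ b}, w.1 ∈ X ∧ (splitGraph G a b α β).Adj x (Sum.inl w))}

/-- `X'` contains both copies of `a` or both copies of `b`. -/
def HasBothCopies {V : Type*} {a b : V} (Z : Set (SplitVertex a b)) : Prop :=
  {copyA 0, copyA 1} ⊆ Z ∨ {copyB 0, copyB 1} ⊆ Z

structure IsSafeNonedgeSplit {V : Type*} (G : SimpleGraph V) (𝒳 : Set (Set V)) (a b : V)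
    (α β : V → Fin 2) : Prop where
  not_adj : ¬ G.Adj a b
  mem_sharedSet : s(a, b) ∈ sharedSet 𝒳
  not_both : ∀ X ∈ 𝒳, (∃ e ∈ sharedSet 𝒳, e ∉ G.edgeSet ∧ e ∈ pairsIn X) →
    ¬ HasBothCopies (splitCluster G a b α β X)
  same_copyA : ∀ X ∈ 𝒳, ∀ Y ∈ 𝒳, ∀ u, u ≠ b → s(a, u) ∈ sharedSet 𝒳 → ¬ G.Adj a u →
    X ∩ Y = {a, u} → splitCluster G a b α β X ∩ {copyA 0, copyA 1} =
      splitCluster G a b α β Y ∩ {copyA 0, copyA 1}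
  same_copyB : ∀ X ∈ 𝒳, ∀ Y ∈ 𝒳, ∀ u, u ≠ a → s(b, u) ∈ sharedSet 𝒳 → ¬ G.Adj b u →
    X ∩ Y = {b, u} → splitCluster G a b α β X ∩ {copyB 0, copyB 1} =
      splitCluster G a b α β Y ∩ {copyB 0, copyB 1}

/-- The clusters of size greater than two of the safe split cover. -/
def bigSplitClusters {V : Type*} (G : SimpleGraph V) (𝒳 : Set (Set V)) (a b : V)
    (α β : V → Fin 2) : Set (Set (SplitVertex a b)) :=
  {Z | (∃ X ∈ 𝒳, Z = splitCluster G a b α β X) ∧ 2 < Z.ncard ∧ ¬ HasBothCopies Z}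

/-- The safe split cover: the big clusters, and the endpoints of each edge of the split graph that
is not contained in a big cluster. -/
def safeSplitCover {V : Type*} (G : SimpleGraph V) (𝒳 : Set (Set V)) (a b : V)
    (α β : V → Fin 2) : Set (Set (SplitVertex a b)) :=
  bigSplitClusters G 𝒳 a b α β ∪
    {Z | (∃ x y, (splitGraph G a b α β).Adj x y ∧ Z = {x, y}) ∧
      ∀ Y ∈ bigSplitClusters G 𝒳 a b α β, ¬ Z ⊆ Y}

/-! ### Gluing -/

open Classical in
/-- The image in the glued vertex set of a vertex of the second graph: a gluing vertex is identified
with its partner under `φ`. -/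
noncomputable def glueRight {V U : Type*} {P : Set V} {Q : Set U} (φ : Q ≃ P) (u : U) :
    V ⊕ {u : U // u ∉ Q} :=
  if h : u ∈ Q then Sum.inl (φ ⟨u, h⟩ : V) else Sum.inr ⟨u, h⟩

/-- The graph obtained from the disjoint union of `G` and `H` by identifying each `q ∈ Q`
with `φ q ∈ P`. -/
noncomputable def glue {V U : Type*} (G : SimpleGraph V) (H : SimpleGraph U) {P : Set V} {Q : Set U}
    (φ : Q ≃ P) : SimpleGraph (V ⊕ {u : U // u ∉ Q}) :=
  G.map Sum.inl ⊔ H.map (glueRight φ)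

/-! ### Safe split-and-glue -/

/-- The conditions on a base graph `G` with its cover, apart from the existence of
a safe nonedge-split. -/
structure IsSafeBase (κ : RigidityKind) {V : Type*} [Finite V] (G : SimpleGraph V)
    (𝒳 : Set (Set V)) : Prop where
  independent : IsIndependent κ G
  cover : IsTwoThinCover G 𝒳
  shared_indep : (rigidityMatroid κ V).Indep (sharedSet 𝒳)
  rank_eq : (rk κ G.edgeSet : ℤ) = rankCount κ G 𝒳 (sharedSet 𝒳)

/-- `H` is a safe ear with safe ear cover `𝒴` and set `Q` of gluing vertices. -/
structure IsSafeEar (κ : RigidityKind) {U : Type*} [Finite U] (H : SimpleGraph U)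
    (𝒴 : Set (Set U)) (Q : Set U) : Prop where
  cover : IsTwoThinCover H 𝒴
  shared_indep : (rigidityMatroid κ U).Indep (sharedSet 𝒴)
  inter_le : ∀ Y ∈ 𝒴, (Y ∩ Q).ncard ≤ 2
  union_indep : (rigidityMatroid κ U).Indep (sharedSet 𝒴 ∪ pairsIn Q)
  rank_eq : (rk κ H.edgeSet : ℤ) = rankCount κ H 𝒴 (sharedSet 𝒴 ∪ keyPairs 𝒴 Q) - 1
  /-- pairs of gluing vertices are nonedges of the ear -/
  nonedges : ∀ x ∈ Q, ∀ y ∈ Q, ¬ H.Adj x y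

/-- A safe split-and-glue: a safe nonedge-split of the safe base graph `G` with cover `𝒳` at the
nonedge `ab`, followed by gluing the safe ear `H` along the bijection `φ` of the gluing vertices,
which matches the key gluing pairs of the two graphs. -/
structure IsSafeSplitAndGlue (κ : RigidityKind) {V U : Type*} [Finite V] [Finite U]
    (G : SimpleGraph V) (𝒳 : Set (Set V)) (a b : V) (α β : V → Fin 2) (P : Set (SplitVertex a b))
    (H : SimpleGraph U) (𝒴 : Set (Set U)) (Q : Set U) (φ : Q ≃ P) : Prop where
  base : IsSafeBase κ G 𝒳
  split : IsSafeNonedgeSplit G 𝒳 a b α β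
  ear : IsSafeEar κ H 𝒴 Q
  gluing_subset : P ⊆ newVertices a b
  key_subset : ∀ e ∈ keyPairs (safeSplitCover G 𝒳 a b α β) (newVertices a b), ∀ x ∈ e, x ∈ P
  key_iff : ∀ x y : Q, s((φ x : SplitVertex a b), (φ y : SplitVertex a b)) ∈
      keyPairs (safeSplitCover G 𝒳 a b α β) (newVertices a b) ↔
    s((x : U), (y : U)) ∈ keyPairs 𝒴 Q

end SplitGlue

open SplitGlue

namespace SplitGlue

/-! ### Rank -/

/-! The implied nonedge comes from rank counting on the two sides of the gluing. Let `K` be the set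
of key gluing pairs. Adding them to the split graph raises its rank by at most |K| - 1
(`IsSafeBase.rk_splitGraph_union_keyPairs`), and adding them to the ear raises its rank by at most 1
(`IsSafeEar.rk_union_keyPairs_le`). Since `K` is independent and lies in both extended sets,
submodularity bounds the rank of the glued graph together with `K` by |E(G^s)| + |K| - 1 + |E(H)| +
1 - |K|, the number of edges of the independent glued graph. So `K` lies in the closure of its
edges. The first bound forces `K` to be nonempty, and its pairs are nonedges.

The ear bound is inclusion-exclusion: for an independent set of pairs, the rank count of a cover is
at least the rank of the graph with these pairs added.

The bound for the split graph transfers the rank formula of `G`. All split clusters are placed in `V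
× Fin 3`, where the index 2 supplies a dummy copy of `a` or `b` for clusters in which that vertex
has no neighbour. An edge of `G` has exactly one lift, and safety makes the lift of every shared
pair other than `ab` unique. Clusterwise submodularity then bounds the rank of the lifted edges and
lifted shared pairs by |E(G)| - 1 plus the number of lifts of `ab`. The lifts of `ab` that avoid the
dummies are the key gluing pairs. The others are attached at dummy vertices of degree at most three,
where each pair raises the rank by one, so they can be deleted from both sides of the estimate.

Nucleation-freeness is an edge count. A rigid subgraph on n ≥ 5 vertices has at least 3n - 6 edges.
Its two parts have at most 3n_i - 7 edges when n_i ≥ 5, and few when n_i is small. If they share at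
least three gluing vertices, collapsing the copies of `a` and `b` gives a subgraph of the
independent graph `G` on fewer vertices, which sharpens the bound for the base side. -/

theorem rigidityMatroid_indep_iff {κ : RigidityKind} {V : Type*} [Finite V] {I : Set (Sym2 V)} :
    (rigidityMatroid κ V).Indep I ↔ RowIndep κ I := Iff.rfl

section Rank

variable {κ : RigidityKind} {V : Type*} [Finite V] {F F' I S : Set (Sym2 V)}

theorem coe_rk (F : Set (Sym2 V)) : (rk κ F : ℕ∞) = (rigidityMatroid κ V).eRk F := by
  refine ENat.natCast_toNat (ne_top_of_le_ne_top ?_ (Matroid.eRk_le_encard _ F))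
  exact (Set.toFinite F).encard_lt_top.ne

theorem rk_mono (h : F ⊆ F') : rk κ F ≤ rk κ F' := by
  have := (rigidityMatroid κ V).eRk_mono h
  rw [← coe_rk, ← coe_rk] at this
  exact_mod_cast this

theorem rk_inter_add_rk_union_le (F F' : Set (Sym2 V)) :
    rk κ (F ∩ F') + rk κ (F ∪ F') ≤ rk κ F + rk κ F' := by
  have := (rigidityMatroid κ V).eRk_inter_add_eRk_union_le F F'
  simp only [← coe_rk] at this
  exact_mod_cast this

theorem rk_le_ncard (F : Set (Sym2 V)) : rk κ F ≤ F.ncard := by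
  have := (rigidityMatroid κ V).eRk_le_encard F
  rw [← coe_rk, ← (Set.toFinite F).cast_ncard_eq] at this
  exact_mod_cast this

theorem rk_eq_ncard (h : (rigidityMatroid κ V).Indep I) : rk κ I = I.ncard := by
  have := h.eRk_eq_encard
  rw [← coe_rk, ← (Set.toFinite I).cast_ncard_eq] at this
  exact_mod_cast this

theorem ncard_le_rk (h : (rigidityMatroid κ V).Indep I) (hI : I ⊆ F) : I.ncard ≤ rk κ F :=
  (rk_eq_ncard h).symm.le.trans (rk_mono hI)

theorem exists_indep_ncard_eq_rk (κ : RigidityKind) (F : Set (Sym2 V)) :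
    ∃ I ⊆ F, (rigidityMatroid κ V).Indep I ∧ I.ncard = rk κ F := by
  obtain ⟨I, hI⟩ := (rigidityMatroid κ V).exists_isBasis' F
  refine ⟨I, hI.subset, hI.indep, ?_⟩
  have := hI.encard_eq_eRk
  rw [← coe_rk, ← (Set.toFinite I).cast_ncard_eq] at this
  exact_mod_cast this

theorem rk_closure (F : Set (Sym2 V)) : rk κ ((rigidityMatroid κ V).closure F) = rk κ F := by
  unfold rk
  rw [Matroid.eRk_closure_eq]

theorem subset_closure_of_rk_le (hF : ∀ e ∈ F', ¬ e.IsDiag) (h : F ⊆ F')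
    (hrk : rk κ F' ≤ rk κ F) : F' ⊆ (rigidityMatroid κ V).closure F := by
  have h1 : (rigidityMatroid κ V).IsRkFinite F := by
    rw [← Matroid.eRk_ne_top_iff, ← coe_rk]
    exact ENat.natCast_ne_top _
  have h2 := h1.closure_eq_closure_of_subset_of_eRk_ge_eRk h
    (by rw [← coe_rk, ← coe_rk]; exact_mod_cast hrk)
  rw [h2]
  exact Matroid.subset_closure _ _ hF

/-- Submodularity, iterated: the rank of `S` together with the sets `A i` is at most the rank of `S`
plus the sum of the ranks of the `A i` relative to parts `T i` of `S`. -/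
theorem rk_union_biUnion_add_sum_le {ι : Type*} (s : Finset ι) (S : Set (Sym2 V))
    (A T : ι → Set (Sym2 V)) (hT : ∀ i ∈ s, T i ⊆ S) :
    rk κ (S ∪ ⋃ i ∈ s, A i) + ∑ i ∈ s, rk κ (T i) ≤ rk κ S + ∑ i ∈ s, rk κ (A i ∪ T i) := by
  classical
  induction s using Finset.induction_on with
  | empty => simp
  | insert i s hi ih =>
    rw [Finset.sum_insert hi, Finset.sum_insert hi]
    have h1 := ih fun j hj => hT j (Finset.mem_insert_of_mem hj)
    have h2 := rk_inter_add_rk_union_le (κ := κ) (S ∪ ⋃ j ∈ s, A j) (A i ∪ T i)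
    have hTi := hT i (Finset.mem_insert_self i s)
    have h3 : rk κ (T i) ≤ rk κ ((S ∪ ⋃ j ∈ s, A j) ∩ (A i ∪ T i)) :=
      rk_mono fun e he => ⟨Or.inl (hTi he), Or.inr he⟩
    have h4 : rk κ (S ∪ ⋃ j ∈ insert i s, A j) ≤ rk κ ((S ∪ ⋃ j ∈ s, A j) ∪ (A i ∪ T i)) := by
      apply rk_mono
      rw [Finset.set_biUnion_insert]
      rintro e (he | he | he)
      · exact Or.inl (Or.inl he)
      · exact Or.inr (Or.inl he)
      · exact Or.inl (Or.inr he)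
    omega

end Rank

/-! ### Rows of ordered pairs, and injective maps of the vertices -/

open Classical in
/-- The row of the ordered pair `(u, v)`; it equals the row of `s(u, v)` up to sign. -/
noncomputable def pairRow {R : Type*} [CommRing R] {V : Type*} (κ : RigidityKind)
    (p : V → Fin κ.dim → R) (u v : V) : V × Fin 3 → R := fun wi =>
  edgeVec κ (p u) (p v) wi.2 * ((if wi.1 = u then 1 else 0) - (if wi.1 = v then 1 else 0))

theorem pairRow_swap {R : Type*} [CommRing R] {V : Type*} (κ : RigidityKind)
    (p : V → Fin κ.dim → R) (u v : V) :
    pairRow κ p v u = pairRow κ p u v ∨ pairRow κ p v u = -pairRow κ p u v := by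
  cases κ with
  | generic =>
    left; ext ⟨w, i⟩; simp only [pairRow, edgeVec]; ring
  | cofactor =>
    right; ext ⟨w, i⟩
    fin_cases i <;> simp [pairRow, edgeVec, cofactorVec] <;> ring

theorem rigidityRow_mk {R : Type*} [CommRing R] {V : Type*} (κ : RigidityKind)
    (p : V → Fin κ.dim → R) (u v : V) :
    rigidityRow κ p s(u, v) = pairRow κ p u v ∨ rigidityRow κ p s(u, v) = -pairRow κ p u v := by
  have h : rigidityRow κ p s(u, v) =
      pairRow κ p (Quot.out s(u, v)).1 (Quot.out s(u, v)).2 := rfl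
  have h2 : s((Quot.out s(u, v)).1, (Quot.out s(u, v)).2) = s(u, v) := Quot.out_eq s(u, v)
  rw [h]
  rcases Sym2.eq_iff.1 h2 with ⟨h3, h4⟩ | ⟨h3, h4⟩
  · left; rw [h3, h4]
  · rw [h3, h4]; exact pairRow_swap κ p u v

/-- Absorbs the sign ambiguity that comes from the choice of an order on each pair when rows are
transported by a linear map. -/
theorem linearIndependent_of_eq_or_eq_neg {ι M N : Type*} [AddCommGroup M] [Module ℝ M]
    [AddCommGroup N] [Module ℝ N] (L : M →ₗ[ℝ] N) (r : ι → M) (r' : ι → N)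
    (h : ∀ i, r' i = L (r i) ∨ r' i = -L (r i)) (hr : LinearIndependent ℝ r') :
    LinearIndependent ℝ r := by
  have h1 : ∀ i, ∃ c : ℝˣ, r' i = c • L (r i) := fun i => by
    rcases h i with h | h
    · exact ⟨1, by simp [h]⟩
    · exact ⟨-1, by simp [h]⟩
  choose c hc using h1
  have h2 : r' = c • (fun i => L (r i)) := funext hc
  rw [h2, LinearIndependent.units_smul_iff] at hr
  exact LinearIndependent.of_comp L hr

open Classical in
theorem ite_map_eq {V T : Type*} {f : V → T} (hf : Function.Injective f) (u v : V) :
    (if f u = f v then (1 : ℝ) else 0) = if u = v then 1 else 0 := by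
  by_cases h : u = v
  · simp [h]
  · simp [h, hf.eq_iff]

theorem pairRow_map {V T : Type*} (κ : RigidityKind) (p : T → Fin κ.dim → ℝ) {f : V → T}
    (hf : Function.Injective f) (u v : V) :
    Function.ExtendByZero.linearMap ℝ (Prod.map f (id : Fin 3 → Fin 3)) (pairRow κ (p ∘ f) u v) =
      pairRow κ p (f u) (f v) := by
  have hF : Function.Injective (Prod.map f (id : Fin 3 → Fin 3)) := hf.prodMap Function.injective_id
  ext ⟨w, i⟩
  rw [Function.ExtendByZero.linearMap_apply]
  by_cases hw : ∃ x, f x = w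
  · obtain ⟨x, rfl⟩ := hw
    have : (f x, i) = Prod.map f (id : Fin 3 → Fin 3) (x, i) := rfl
    rw [this, hF.extend_apply]
    simp only [pairRow, Function.comp_apply, Prod.map_apply, id, ite_map_eq hf]
  · rw [Function.extend_apply']
    · have h1 : w ≠ f u := fun h => hw ⟨u, h.symm⟩
      have h2 : w ≠ f v := fun h => hw ⟨v, h.symm⟩
      simp [pairRow, h1, h2]
    · rintro ⟨⟨x, j⟩, h⟩
      exact hw ⟨x, congrArg Prod.fst h⟩

theorem pairRow_comap {V T : Type*} (κ : RigidityKind) (p : T → Fin κ.dim → ℝ) {f : V → T}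
    (hf : Function.Injective f) (u v : V) :
    LinearMap.funLeft ℝ ℝ (Prod.map f (id : Fin 3 → Fin 3)) (pairRow κ p (f u) (f v)) =
      pairRow κ (p ∘ f) u v := by
  ext ⟨w, i⟩
  simp only [LinearMap.funLeft_apply, Prod.map_apply, id, pairRow, Function.comp_apply,
    ite_map_eq hf]

theorem isDiag_map_iff {V T : Type*} {f : V → T} (hf : Function.Injective f) (e : Sym2 V) :
    (Sym2.map f e).IsDiag ↔ e.IsDiag := by
  induction e with | _ u v => simp [hf.eq_iff]

/-- A placement of `T` restricts along `f`, and every placement of `V` is such a restriction. Up to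
sign, the rows over `T` are those over `V` extended by zero columns, so independence passes in both
directions. -/
theorem indep_image_map_iff {κ : RigidityKind} {V T : Type*} [Finite V] [Finite T] {f : V → T}
    (hf : Function.Injective f) {I : Set (Sym2 V)} :
    (rigidityMatroid κ T).Indep (Sym2.map f '' I) ↔ (rigidityMatroid κ V).Indep I := by
  simp only [rigidityMatroid_indep_iff, RowIndep]
  refine and_congr ?_ ⟨?_, ?_⟩
  · simp [Set.subset_def, isDiag_map_iff hf]
  · rintro ⟨p, hp⟩
    refine ⟨p ∘ f, ?_⟩
    have h1 : LinearIndependent ℝ fun e : I => rigidityRow κ p (Sym2.map f e.1) := by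
      refine LinearIndependent.comp hp
        (fun e : I => (⟨Sym2.map f e.1, Set.mem_image_of_mem _ e.2⟩ : Sym2.map f '' I)) ?_
      intro e e' h
      exact Subtype.ext (Sym2.map.injective hf (congrArg Subtype.val h))
    refine linearIndependent_of_eq_or_eq_neg
      (Function.ExtendByZero.linearMap ℝ (Prod.map f (id : Fin 3 → Fin 3))) _ _ ?_ h1
    rintro ⟨e, he⟩
    induction e with | _ u v =>
    dsimp only
    rw [Sym2.map_mk]
    rcases rigidityRow_mk κ p (f u) (f v) with h | h <;>
    rcases rigidityRow_mk κ (p ∘ f) u v with h' | h' <;>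
    rw [h, h', ← pairRow_map κ p hf] <;> simp
  · rintro ⟨q, hq⟩
    obtain ⟨p, rfl⟩ : ∃ p : T → Fin κ.dim → ℝ, p ∘ f = q :=
      ⟨Function.extend f q 0, Function.extend_comp hf q 0⟩
    refine ⟨p, LinearIndepOn.image_of_comp _ _ ?_⟩
    refine linearIndependent_of_eq_or_eq_neg
      (LinearMap.funLeft ℝ ℝ (Prod.map f (id : Fin 3 → Fin 3))) _ _ ?_ hq
    rintro ⟨e, he⟩
    induction e with | _ u v =>
    simp only [Function.comp_apply]
    rw [Sym2.map_mk]
    rcases rigidityRow_mk κ p (f u) (f v) with h | h <;>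
    rcases rigidityRow_mk κ (p ∘ f) u v with h' | h' <;>
    rw [h, h', ← pairRow_comap κ p hf] <;> simp

theorem rk_image_map {κ : RigidityKind} {V T : Type*} [Finite V] [Finite T] {f : V → T}
    (hf : Function.Injective f) (F : Set (Sym2 V)) : rk κ (Sym2.map f '' F) = rk κ F := by
  apply le_antisymm
  · obtain ⟨J, hJ, hJi, hJc⟩ := exists_indep_ncard_eq_rk κ (Sym2.map f '' F)
    obtain ⟨I, hI, rfl⟩ := Set.subset_image_iff.1 hJ
    rw [← hJc, Set.ncard_image_of_injective _ (Sym2.map.injective hf)]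
    exact ncard_le_rk ((indep_image_map_iff hf).1 hJi) hI
  · obtain ⟨I, hI, hIi, hIc⟩ := exists_indep_ncard_eq_rk κ F
    rw [← hIc, ← Set.ncard_image_of_injective I (Sym2.map.injective hf)]
    exact ncard_le_rk ((indep_image_map_iff hf).2 hIi) (Set.image_mono hI)

/-! ### Generic placements -/

theorem eval_gram_det_ne_zero_iff {σ ι m : Type*} [Fintype ι] [DecidableEq ι] [Fintype m]
    (C : Matrix ι m (MvPolynomial σ ℝ)) (z : σ → ℝ) :
    MvPolynomial.eval z (C * C.transpose).det ≠ 0 ↔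
      LinearIndependent ℝ fun i j => MvPolynomial.eval z (C i j) := by
  rw [RingHom.map_det, RingHom.mapMatrix_apply, Matrix.map_mul, Matrix.transpose_map,
    gram_det_ne_zero_iff]
  rfl

/-- Full row rank over the reals is the nonvanishing of a Gram determinant, a polynomial in the
parameters. The product of two nonzero polynomials is nonzero and therefore has a real nonroot. -/
theorem exists_common_eval {σ ι ι' m m' : Type*} [Finite ι] [Finite ι'] [Finite m] [Finite m']
    (A : ι → m → MvPolynomial σ ℝ) (B : ι' → m' → MvPolynomial σ ℝ) {x y : σ → ℝ}
    (hA : LinearIndependent ℝ fun i j => MvPolynomial.eval x (A i j))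
    (hB : LinearIndependent ℝ fun i j => MvPolynomial.eval y (B i j)) :
    ∃ z : σ → ℝ, (LinearIndependent ℝ fun i j => MvPolynomial.eval z (A i j)) ∧
      LinearIndependent ℝ fun i j => MvPolynomial.eval z (B i j) := by
  classical
  have := Fintype.ofFinite ι
  have := Fintype.ofFinite ι'
  have := Fintype.ofFinite m
  have := Fintype.ofFinite m'
  have hA' := (eval_gram_det_ne_zero_iff (Matrix.of A) x).2 hA
  have hB' := (eval_gram_det_ne_zero_iff (Matrix.of B) y).2 hB
  have hne : (Matrix.of A * (Matrix.of A).transpose).det *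
      (Matrix.of B * (Matrix.of B).transpose).det ≠ 0 := by
    refine mul_ne_zero ?_ ?_
    · intro h; simp [h] at hA'
    · intro h; simp [h] at hB'
  obtain ⟨z, hz⟩ : ∃ z, MvPolynomial.eval z ((Matrix.of A * (Matrix.of A).transpose).det *
      (Matrix.of B * (Matrix.of B).transpose).det) ≠ 0 := by
    by_contra! h
    exact hne (MvPolynomial.funext (by simpa using h))
  rw [map_mul] at hz
  exact ⟨z, (eval_gram_det_ne_zero_iff _ z).1 (left_ne_zero_of_mul hz),
    (eval_gram_det_ne_zero_iff _ z).1 (right_ne_zero_of_mul hz)⟩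

theorem eval_rigidityRow_X {V : Type*} (κ : RigidityKind) (z : V × Fin κ.dim → ℝ) (e : Sym2 V)
    (w : V × Fin 3) :
    MvPolynomial.eval z (rigidityRow κ (fun v j => MvPolynomial.X (v, j)) e w) =
      rigidityRow κ (fun v j => z (v, j)) e w := by
  rw [rigidityRow_map]
  simp

theorem eval_edgeVec_X {V : Type*} (κ : RigidityKind) (z : V × Fin κ.dim → ℝ) (u v : V)
    (i : Fin 3) :
    MvPolynomial.eval z (edgeVec κ (fun j => MvPolynomial.X (u, j))
      (fun j => MvPolynomial.X (v, j)) i) =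
      edgeVec κ (fun j => z (u, j)) (fun j => z (v, j)) i := by
  rw [edgeVec_map]
  simp

/-- If `I` is independent and a polynomial condition of full rank on placements can be satisfied,
then it can be satisfied by a placement in which the rows of `I` are linearly independent. -/
theorem RowIndep.exists_placement {κ : RigidityKind} {V : Type*} [Finite V] {I : Set (Sym2 V)}
    (hI : RowIndep κ I) {ι m : Type*} [Finite ι] [Finite m]
    (B : ι → m → MvPolynomial (V × Fin κ.dim) ℝ) {y : V × Fin κ.dim → ℝ}
    (hB : LinearIndependent ℝ fun i j => MvPolynomial.eval y (B i j)) :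
    ∃ z : V × Fin κ.dim → ℝ, LinearIndepOn ℝ (rigidityRow κ fun v j => z (v, j)) I ∧
      LinearIndependent ℝ fun i j => MvPolynomial.eval z (B i j) := by
  obtain ⟨-, p, hp⟩ := hI
  have hA : LinearIndependent ℝ fun (e : I) w => MvPolynomial.eval (fun x => p x.1 x.2)
      (rigidityRow κ (fun v j => MvPolynomial.X (v, j)) e.1 w) := by
    simp only [eval_rigidityRow_X]
    exact hp
  obtain ⟨z, hz, hz'⟩ := exists_common_eval
    (fun (e : I) w => rigidityRow κ (fun v j => MvPolynomial.X (v, j)) e.1 w) B hA hB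
  refine ⟨z, ?_, hz'⟩
  simp only [eval_rigidityRow_X] at hz
  exact hz

/-! ### Adding a vertex of degree at most three -/

theorem linearIndependent_cofactorVec :
    LinearIndependent ℝ fun i => cofactorVec (0 : Fin 2 → ℝ) (![![1, 0], ![0, 1], ![1, 1]] i) := by
  rw [Fintype.linearIndependent_iff]
  intro g hg
  have h0 := congrFun hg 0
  have h1 := congrFun hg 1
  have h2 := congrFun hg 2
  simp [Fin.sum_univ_three, cofactorVec] at h0 h1 h2
  intro i
  fin_cases i <;> simp <;> linarith

theorem exists_linearIndependent_edgeVec (κ : RigidityKind) :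
    ∃ pt : Fin 3 → Fin κ.dim → ℝ, LinearIndependent ℝ fun i => edgeVec κ 0 (pt i) := by
  cases κ with
  | generic =>
    refine ⟨fun i => -Pi.single (M := fun _ : Fin 3 => ℝ) i 1, ?_⟩
    convert (Pi.basisFun ℝ (Fin 3)).linearIndependent using 1
    ext i j
    rw [Pi.basisFun_apply]
    exact (zero_sub _).trans (neg_neg _)
  | cofactor => exact ⟨_, linearIndependent_cofactorVec⟩

/-- The pairs that join `v` to the elements of `U`. -/
def star {V : Type*} (v : V) (U : Set V) : Set (Sym2 V) := (fun u => s(v, u)) '' U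

theorem ncard_star {V : Type*} (v : V) (U : Set V) : (star v U).ncard = U.ncard := by
  refine Set.ncard_image_of_injective _ fun u u' h => Sym2.congr_right.1 h

theorem mem_of_mem_star {V : Type*} {v : V} {U : Set V} {e : Sym2 V} (he : e ∈ star v U) :
    v ∈ e := by
  obtain ⟨u, -, rfl⟩ := he
  simp

/-- The matrix is block triangular: rows of `I` vanish in the three columns of `v`, and there the
star contributes at most three edge vectors, which are independent for a generic placement. -/
theorem indep_union_star {κ : RigidityKind} {V : Type*} [Finite V] {I : Set (Sym2 V)}
    (hI : (rigidityMatroid κ V).Indep I) {v : V} (hv : ∀ e ∈ I, v ∉ e) {U : Set V} (hvU : v ∉ U)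
    (hU : U.ncard ≤ 3) : (rigidityMatroid κ V).Indep (I ∪ star v U) := by
  classical
  obtain ⟨pt, hpt⟩ := exists_linearIndependent_edgeVec κ
  obtain ⟨g⟩ : Nonempty (U ↪ Fin 3) := by
    have := Fintype.ofFinite U
    apply Function.Embedding.nonempty_of_card_le
    rwa [← Nat.card_eq_fintype_card, Nat.card_coe_set_eq, Fintype.card_fin]
  -- Only the star needs independent edge vectors here, so `v` sits at the origin and `U` at the
  -- chosen points; compatibility with `I` is supplied by `exists_placement`.
  let y : V × Fin κ.dim → ℝ := fun x => if h : x.1 ∈ U then pt (g ⟨x.1, h⟩) x.2 else 0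
  have hy : LinearIndependent ℝ fun (u : U) i => MvPolynomial.eval y
      (edgeVec κ (fun j => MvPolynomial.X (v, j)) (fun j => MvPolynomial.X (u.1, j)) i) := by
    simp only [eval_edgeVec_X]
    convert hpt.comp g g.injective using 1
    ext u i
    have h1 : (fun j => y (v, j)) = 0 := by ext j; simp [y, hvU]
    have h2 : (fun j => y (u.1, j)) = pt (g u) := by ext j; simp [y]
    rw [h1, h2]
    rfl
  obtain ⟨z, hzI, hz⟩ := (rigidityMatroid_indep_iff.1 hI).exists_placement _ hy
  simp only [eval_edgeVec_X] at hz
  have hdiag : I ∪ star v U ⊆ {e | ¬ e.IsDiag} := by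
    rintro e (he | ⟨u, hu, rfl⟩)
    · exact hI.subset_ground he
    · exact fun h => hvU (by simpa [Sym2.mk_isDiag_iff.1 h] using hu)
  refine ⟨hdiag, fun v j => z (v, j), hzI.union_of_quotient ?_⟩
  let π : (V × Fin 3 → ℝ) →ₗ[ℝ] (Fin 3 → ℝ) := LinearMap.funLeft ℝ ℝ fun i => (v, i)
  have hπ : Submodule.span ℝ (rigidityRow κ (fun v j => z (v, j)) '' I) ≤ LinearMap.ker π := by
    rw [Submodule.span_le]
    rintro _ ⟨e, he, rfl⟩
    have hve := hv e he
    induction e with | _ u w =>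
    simp only [Sym2.mem_iff, not_or] at hve
    have : π (pairRow κ (fun v j => z (v, j)) u w) = 0 := by
      ext i
      simp [π, LinearMap.funLeft_apply, pairRow, hve]
    rcases rigidityRow_mk κ (fun v j => z (v, j)) u w with h | h <;>
      simp [h, this]
  refine LinearIndepOn.image_of_comp _ _ ?_
  refine linearIndependent_of_eq_or_eq_neg (Submodule.liftQ _ π hπ) _ _ ?_ hz
  rintro ⟨u, hu⟩
  have hne : v ≠ u := fun h => hvU (h ▸ hu)
  have : π (pairRow κ (fun v j => z (v, j)) v u) =
      edgeVec κ (fun j => z (v, j)) (fun j => z (u, j)) := by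
    ext i
    simp [π, LinearMap.funLeft_apply, pairRow, hne]
  rcases rigidityRow_mk κ (fun v j => z (v, j)) v u with h | h <;>
    simp [h, this]

theorem rk_add_ncard_le_rk_union_star {κ : RigidityKind} {V : Type*} [Finite V] {F : Set (Sym2 V)}
    {v : V} (hv : ∀ e ∈ F, v ∉ e) {U : Set V} (hvU : v ∉ U) (hU : U.ncard ≤ 3) :
    rk κ F + U.ncard ≤ rk κ (F ∪ star v U) := by
  obtain ⟨I, hIF, hI, hIc⟩ := exists_indep_ncard_eq_rk κ F
  have h := indep_union_star hI (fun e he => hv e (hIF he)) hvU hU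
  rw [← hIc, ← ncard_star v U, ← Set.ncard_union_eq]
  · exact ncard_le_rk h (Set.union_subset_union_left _ hIF)
  · exact Set.disjoint_left.2 fun e he he' => hv e (hIF he) (mem_of_mem_star he')

/-! ### The rank of a complete graph -/

theorem pairsIn_mono {V : Type*} {X Y : Set V} (h : X ⊆ Y) : pairsIn X ⊆ pairsIn Y :=
  fun _ he => ⟨he.1, fun v hv => h (he.2 v hv)⟩

theorem mk_mem_pairsIn {V : Type*} {X : Set V} {u v : V} :
    s(u, v) ∈ pairsIn X ↔ u ≠ v ∧ u ∈ X ∧ v ∈ X := by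
  simp [pairsIn]

theorem rk_pairsIn_insert (κ : RigidityKind) {V : Type*} [Finite V] {v : V} {X : Set V}
    (hv : v ∉ X) : rk κ (pairsIn X) + min 3 X.ncard ≤ rk κ (pairsIn (insert v X)) := by
  obtain ⟨U, hUX, hU⟩ := Set.exists_subset_card_eq (min_le_right 3 X.ncard)
  rw [← hU]
  refine (rk_add_ncard_le_rk_union_star (fun e he hve => hv (he.2 v hve)) (fun h => hv (hUX h))
    (hU.le.trans (min_le_left _ _))).trans (rk_mono ?_)
  refine Set.union_subset (pairsIn_mono (Set.subset_insert _ _)) ?_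
  rintro _ ⟨u, hu, rfl⟩
  refine mk_mem_pairsIn.2 ⟨fun h => hv (h ▸ hUX hu), Set.mem_insert _ _, ?_⟩
  exact Set.mem_insert_of_mem _ (hUX hu)

theorem three_mul_ncard_le_rk_pairsIn_add_six (κ : RigidityKind) {V : Type*} [Finite V]
    (X : Set V) (hX : 3 ≤ X.ncard) : 3 * X.ncard ≤ rk κ (pairsIn X) + 6 := by
  -- The formula 3n - 6 starts at n = 3, so the induction also carries the rank of a single pair;
  -- the third vertex then adds two.
  suffices h : (X.ncard = 2 → 1 ≤ rk κ (pairsIn X)) ∧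
      (3 ≤ X.ncard → 3 * X.ncard ≤ rk κ (pairsIn X) + 6) from h.2 hX
  clear hX
  induction X, Set.toFinite X using Set.Finite.induction_on with
  | empty => simp
  | @insert v X hv _ ih =>
    have h := rk_pairsIn_insert κ hv
    rw [Set.ncard_insert_of_notMem hv]
    omega

/-- Six independent infinitesimal motions, which every bar preserves, in each of the two cases. -/
def genericMotion {R : Type*} [CommRing R] (x : Fin 3 → R) : Fin 6 → Fin 3 → R :=
  ![![1, 0, 0], ![0, 1, 0], ![0, 0, 1], ![0, -x 2, x 1], ![x 2, 0, -x 0], ![-x 1, x 0, 0]]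

def cofactorMotion {R : Type*} [CommRing R] (x : Fin 2 → R) : Fin 6 → Fin 3 → R :=
  ![![1, 0, 0], ![0, 1, 0], ![0, 0, 1], ![x 1, -x 0, 0], ![0, x 1, -x 0],
    ![x 1 ^ 2, -(x 0 * x 1 + x 0 * x 1), x 0 ^ 2]]

def motion {R : Type*} [CommRing R] : (κ : RigidityKind) → (Fin κ.dim → R) → Fin 6 → Fin 3 → R
  | .generic => genericMotion
  | .cofactor => cofactorMotion

theorem motion_map {R S : Type*} [CommRing R] [CommRing S] (f : R →+* S) (κ : RigidityKind)
    (x : Fin κ.dim → R) (k : Fin 6) (i : Fin 3) :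
    f (motion κ x k i) = motion κ (fun j => f (x j)) k i := by
  cases κ with
  | generic => fin_cases k <;> fin_cases i <;> simp [motion, genericMotion]
  | cofactor => fin_cases k <;> fin_cases i <;> simp [motion, cofactorMotion]

theorem edgeVec_dotProduct_motion {κ : RigidityKind} (x y : Fin κ.dim → ℝ) (k : Fin 6) :
    edgeVec κ x y ⬝ᵥ motion κ x k = edgeVec κ x y ⬝ᵥ motion κ y k := by
  cases κ with
  | generic =>
    fin_cases k <;> simp [motion, genericMotion, edgeVec, dotProduct, Fin.sum_univ_three] <;> ring
  | cofactor =>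
    fin_cases k <;>
      simp [motion, cofactorMotion, edgeVec, cofactorVec, dotProduct, Fin.sum_univ_three] <;> ring

theorem rigidityRow_dotProduct_motion {κ : RigidityKind} {V : Type*} [Fintype V]
    (p : V → Fin κ.dim → ℝ) (e : Sym2 V) (k : Fin 6) :
    rigidityRow κ p e ⬝ᵥ (fun w : V × Fin 3 => motion κ (p w.1) k w.2) = 0 := by
  classical
  induction e with | _ u v =>
  have h : pairRow κ p u v ⬝ᵥ (fun w : V × Fin 3 => motion κ (p w.1) k w.2) = 0 := by
    have h1 := edgeVec_dotProduct_motion (p u) (p v) k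
    simp only [dotProduct, Fintype.sum_prod_type, pairRow] at h1 ⊢
    rw [Finset.sum_comm]
    simp only [mul_sub, sub_mul, Finset.sum_sub_distrib, mul_ite, ite_mul, mul_one, mul_zero,
      zero_mul, Finset.sum_ite_eq', Finset.mem_univ, if_true]
    rw [h1, sub_self]
  rcases rigidityRow_mk κ p u v with h' | h' <;> simp [h', h]

theorem linearIndependent_genericMotion : LinearIndependent ℝ fun (k : Fin 6) (w : Fin 3 × Fin 3) =>
    genericMotion ((![0, ![1, 0, 0], ![0, 1, 0]] : Fin 3 → Fin 3 → ℝ) w.1) k w.2 := by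
  rw [Fintype.linearIndependent_iff]
  intro g hg
  have h (a b : Fin 3) := congrFun hg (a, b)
  have h00 := h 0 0
  have h01 := h 0 1
  have h02 := h 0 2
  have h11 := h 1 1
  have h12 := h 1 2
  have h20 := h 2 0
  have h22 := h 2 2
  simp [Fin.sum_univ_six, genericMotion] at h00 h01 h02 h11 h12 h20 h22
  intro i
  fin_cases i <;> simp <;> linarith

theorem linearIndependent_cofactorMotion :
    LinearIndependent ℝ fun (k : Fin 6) (w : Fin 3 × Fin 3) =>
      cofactorMotion ((![0, ![1, 0], ![0, 1]] : Fin 3 → Fin 2 → ℝ) w.1) k w.2 := by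
  rw [Fintype.linearIndependent_iff]
  intro g hg
  have h (a b : Fin 3) := congrFun hg (a, b)
  have h00 := h 0 0
  have h01 := h 0 1
  have h02 := h 0 2
  have h11 := h 1 1
  have h12 := h 1 2
  have h20 := h 2 0
  have h21 := h 2 1
  simp [Fin.sum_univ_six, cofactorMotion] at h00 h01 h02 h11 h12 h20 h21
  intro i
  fin_cases i <;> simp <;> linarith

theorem exists_linearIndependent_motion (κ : RigidityKind) : ∃ pt : Fin 3 → Fin κ.dim → ℝ,
    LinearIndependent ℝ fun (k : Fin 6) (w : Fin 3 × Fin 3) => motion κ (pt w.1) k w.2 := by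
  cases κ with
  | generic => exact ⟨_, linearIndependent_genericMotion⟩
  | cofactor => exact ⟨_, linearIndependent_cofactorMotion⟩

/-- At a placement where both families are independent, the rows of `I` are orthogonal to the six
motions, so the two spans have dimensions adding up to at most 3|V|. -/
theorem RowIndep.ncard_add_six_le {κ : RigidityKind} {V : Type*} [Finite V] {I : Set (Sym2 V)}
    (hI : RowIndep κ I) (hV : 3 ≤ Nat.card V) : I.ncard + 6 ≤ 3 * Nat.card V := by
  classical
  have := Fintype.ofFinite V
  obtain ⟨pt, hpt⟩ := exists_linearIndependent_motion κ
  obtain ⟨g⟩ : Nonempty (Fin 3 ↪ V) := by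
    apply Function.Embedding.nonempty_of_card_le
    rwa [← Nat.card_eq_fintype_card (α := V), Fintype.card_fin]
  let y : V × Fin κ.dim → ℝ := fun x => Function.extend g pt 0 x.1 x.2
  have hy : LinearIndependent ℝ fun (k : Fin 6) (w : V × Fin 3) => MvPolynomial.eval y
      (motion κ (fun j => MvPolynomial.X (w.1, j)) k w.2) := by
    refine LinearIndependent.of_comp (LinearMap.funLeft ℝ ℝ (Prod.map g id)) ?_
    convert hpt using 1
    ext k w
    simp [LinearMap.funLeft_apply, motion_map, y, g.injective.extend_apply]
  obtain ⟨z, hzI, hz⟩ := hI.exists_placement _ hy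
  simp only [motion_map, MvPolynomial.eval_X] at hz
  set p : V → Fin κ.dim → ℝ := fun v j => z (v, j) with hp
  have hdisj : Disjoint (Submodule.span ℝ (Set.range fun e : I => rigidityRow κ p e.1))
      (Submodule.span ℝ (Set.range fun (k : Fin 6) (w : V × Fin 3) => motion κ (p w.1) k w.2)) := by
    rw [Submodule.disjoint_def]
    intro x hx hx'
    have h1 : ∀ k, x ⬝ᵥ (fun w : V × Fin 3 => motion κ (p w.1) k w.2) = 0 := by
      intro k
      clear hx'
      induction hx using Submodule.span_induction with
      | mem x h => obtain ⟨e, rfl⟩ := h; exact rigidityRow_dotProduct_motion p e.1 k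
      | zero => simp
      | add x y _ _ h h' => rw [add_dotProduct, h, h', add_zero]
      | smul c x _ h => rw [smul_dotProduct, h, smul_zero]
    have h2 : ∀ x' ∈ Submodule.span ℝ
        (Set.range fun (k : Fin 6) (w : V × Fin 3) => motion κ (p w.1) k w.2), x ⬝ᵥ x' = 0 := by
      intro x' hx'
      induction hx' using Submodule.span_induction with
      | mem x' h => obtain ⟨k, rfl⟩ := h; exact h1 k
      | zero => simp
      | add x y _ _ h h' => rw [dotProduct_add, h, h', add_zero]
      | smul c x _ h => rw [dotProduct_smul, h, smul_zero]
    exact dotProduct_self_eq_zero.1 (h2 x hx')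
  have h3 := Submodule.finrank_add_finrank_le_of_disjoint hdisj
  have := Fintype.ofFinite I
  rw [finrank_span_eq_card hz, finrank_span_eq_card hzI, Module.finrank_fintype_fun_eq_card,
    Fintype.card_prod, Fintype.card_fin, Fintype.card_fin, ← Nat.card_eq_fintype_card,
    ← Nat.card_eq_fintype_card, Nat.card_coe_set_eq] at h3
  omega

theorem pairsIn_eq_image_val {V : Type*} (X : Set V) :
    pairsIn X = Sym2.map (Subtype.val : X → V) '' {e | ¬ e.IsDiag} := by
  ext e
  constructor
  · induction e with | _ u v =>
    intro he
    obtain ⟨hne, hu, hv⟩ := mk_mem_pairsIn.1 he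
    exact ⟨s(⟨u, hu⟩, ⟨v, hv⟩), by simpa using hne, rfl⟩
  · rintro ⟨e, he, rfl⟩
    induction e with | _ u v =>
    refine mk_mem_pairsIn.2 ⟨?_, u.2, v.2⟩
    simpa [Subtype.ext_iff] using he

theorem rk_pairsIn_add_six_le (κ : RigidityKind) {V : Type*} [Finite V] (X : Set V)
    (hX : 3 ≤ X.ncard) : rk κ (pairsIn X) + 6 ≤ 3 * X.ncard := by
  rw [pairsIn_eq_image_val, rk_image_map Subtype.val_injective]
  obtain ⟨I, -, hI, hIc⟩ := exists_indep_ncard_eq_rk κ {e : Sym2 X | ¬ e.IsDiag}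
  rw [← hIc]
  exact (rigidityMatroid_indep_iff.1 hI).ncard_add_six_le (by rwa [Nat.card_coe_set_eq])

theorem ncard_pairsIn {V : Type*} [Finite V] (X : Set V) :
    (pairsIn X).ncard = X.ncard.choose 2 := by
  classical
  have := Fintype.ofFinite X
  rw [pairsIn_eq_image_val, Set.ncard_image_of_injective _ (Sym2.map.injective
    Subtype.val_injective), ← Nat.card_coe_set_eq, ← Nat.card_coe_set_eq,
    Nat.card_eq_fintype_card, Nat.card_eq_fintype_card]
  exact Sym2.card_subtype_not_diag

/-! ### The rank count of a cover -/

theorem inter_pairsIn_eq {V : Type*} {S : Set (Sym2 V)} (hS : ∀ e ∈ S, ¬ e.IsDiag) (X : Set V) :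
    S ∩ pairsIn X = {e ∈ S | ∀ v ∈ e, v ∈ X} := by
  ext e
  exact ⟨fun h => ⟨h.1, h.2.2⟩, fun h => ⟨h.1, hS e h.1, h.2⟩⟩

/-- Double counting of incidences between pairs in `S` and clusters replaces the degree sum by a sum
over clusters, the form in which submodularity is applied. -/
theorem rankCount_eq (κ : RigidityKind) {V : Type*} [Finite V] (G : SimpleGraph V)
    (𝒳 : Finset (Set V)) {S : Set (Sym2 V)} (hS : ∀ e ∈ S, ¬ e.IsDiag) :
    rankCount κ G 𝒳 S = (∑ X ∈ 𝒳, rk κ ((G.edgeSet ∪ S) ∩ pairsIn X) : ℕ) -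
      (∑ X ∈ 𝒳, (S ∩ pairsIn X).ncard : ℕ) + (S.ncard : ℤ) := by
  classical
  lift S to Finset (Sym2 V) using Set.toFinite S
  have h1 : ∑ X ∈ 𝒳, ((S : Set (Sym2 V)) ∩ pairsIn X).ncard = ∑ e ∈ S, coverDegree ↑𝒳 e := by
    have := Finset.sum_card_bipartiteAbove_eq_sum_card_bipartiteBelow (s := 𝒳) (t := S)
      fun (X : Set V) (e : Sym2 V) => ∀ v ∈ e, v ∈ X
    convert this using 2 with X _ e _
    · rw [inter_pairsIn_eq hS, ← Set.ncard_coe_finset]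
      congr 1
      ext e
      simp [Finset.bipartiteAbove]
    · rw [coverDegree, ← Set.ncard_coe_finset]
      congr 1
      ext X
      simp [Finset.bipartiteBelow]
  rw [h1, rankCount, finsum_mem_coe_finset, finsum_mem_coe_finset, Finset.sum_sub_distrib,
    Set.ncard_coe_finset]
  simp
  ring

/-- Start from the independent set `S` and add the edges cluster by cluster; by submodularity the
cluster `X` adds at most its own rank minus the number of pairs of `S` inside it. -/
theorem rk_edgeSet_union_le_rankCount {κ : RigidityKind} {V : Type*} [Finite V]
    {G : SimpleGraph V} {𝒳 : Set (Set V)} (h𝒳 : IsTwoThinCover G 𝒳) {S : Set (Sym2 V)}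
    (hS : (rigidityMatroid κ V).Indep S) :
    (rk κ (G.edgeSet ∪ S) : ℤ) ≤ rankCount κ G 𝒳 S := by
  lift 𝒳 to Finset (Set V) using Set.toFinite 𝒳
  rw [rankCount_eq κ G 𝒳 fun e he => hS.subset_ground he]
  have h := rk_union_biUnion_add_sum_le (κ := κ) 𝒳 S (fun X => G.edgeSet ∩ pairsIn X)
    (fun X => S ∩ pairsIn X) fun X _ => Set.inter_subset_left
  have h1 : rk κ (G.edgeSet ∪ S) ≤ rk κ (S ∪ ⋃ X ∈ 𝒳, G.edgeSet ∩ pairsIn X) := by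
    refine rk_mono (Set.union_subset (fun e he => Or.inr ?_) Set.subset_union_left)
    obtain ⟨X, hX, heX⟩ := h𝒳.covers e he
    exact Set.mem_biUnion hX ⟨he, heX⟩
  have h2 : ∑ X ∈ 𝒳, rk κ (S ∩ pairsIn X) = ∑ X ∈ 𝒳, (S ∩ pairsIn X).ncard :=
    Finset.sum_congr rfl fun X _ => rk_eq_ncard (hS.subset Set.inter_subset_left)
  have h3 : rk κ S = S.ncard := rk_eq_ncard hS
  simp only [← Set.union_inter_distrib_right] at h
  omega

/-! ### Nonedge-splits -/

section Split

variable {V : Type*} {a b : V}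

theorem collapse_eq_left_iff (hab : a ≠ b) {x : SplitVertex a b} :
    collapse x = a ↔ ∃ i, x = copyA i := by
  rcases x with v | i | i
  · simpa [collapse] using v.2.1
  · simp [collapse]
  · simpa [collapse] using hab.symm

theorem collapse_eq_right_iff (hab : a ≠ b) {x : SplitVertex a b} :
    collapse x = b ↔ ∃ i, x = copyB i := by
  rcases x with v | i | i
  · simpa [collapse] using v.2.2
  · simpa [collapse] using hab
  · simp [collapse]

theorem mem_newVertices_iff {x : SplitVertex a b} :
    x ∈ newVertices a b ↔ collapse x = a ∨ collapse x = b := by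
  rcases x with v | i | i
  · simpa [newVertices, collapse] using v.2
  · simp [newVertices, collapse]
  · simp [newVertices, collapse]

/-- The only distinct vertices that `collapse` identifies are the two copies of `a` and the two
copies of `b`. -/
theorem injOn_collapse (hab : a ≠ b) {Z : Set (SplitVertex a b)} (hZ : ¬ HasBothCopies Z) :
    Set.InjOn collapse Z := by
  have hfin : ∀ i j : Fin 2, i ≠ j → ({i, j} : Set (Fin 2)) = {0, 1} := by
    intro i j h
    fin_cases i <;> fin_cases j <;> simp_all [Set.pair_comm]
  have himg : ∀ (f : Fin 2 → SplitVertex a b), ({f 0, f 1} : Set _) = f '' {0, 1} := by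
    intro f; rw [Set.image_pair]
  intro x hx y hy hxy
  by_contra hne
  rcases x with v | i | i
  · rcases y with w | j | j
    · exact hne (congrArg Sum.inl (Subtype.ext hxy))
    · exact v.2.1 hxy
    · exact v.2.2 hxy
  · obtain ⟨j, rfl⟩ := (collapse_eq_left_iff hab).1 hxy.symm
    refine hZ (Or.inl ?_)
    rw [himg copyA, ← hfin i j (fun h => hne (by rw [h])), Set.image_pair]
    exact Set.pair_subset hx hy
  · obtain ⟨j, rfl⟩ := (collapse_eq_right_iff hab).1 hxy.symm
    refine hZ (Or.inr ?_)
    rw [himg copyB, ← hfin i j (fun h => hne (by rw [h])), Set.image_pair]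
    exact Set.pair_subset hx hy

/-- The vertices of the split graph, as vertices of `V` with an index. The index `2` is not used
for the copies of `a` and `b`. -/
def splitEmb : SplitVertex a b → V × Fin 3
  | Sum.inl v => (v, 0)
  | Sum.inr (Sum.inl i) => (a, i.castSucc)
  | Sum.inr (Sum.inr i) => (b, i.castSucc)

theorem splitEmb_fst (x : SplitVertex a b) : (splitEmb x).1 = collapse x := by
  rcases x with v | i | i <;> rfl

theorem splitEmb_snd_ne (x : SplitVertex a b) : (splitEmb x).2 ≠ 2 := by
  rcases x with v | i | i
  · simp [splitEmb]
  · fin_cases i <;> simp [splitEmb]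
  · fin_cases i <;> simp [splitEmb]

theorem splitEmb_injective (hab : a ≠ b) : Function.Injective (splitEmb : SplitVertex a b → _) := by
  intro x y hxy
  have h1 : collapse x = collapse y := by rw [← splitEmb_fst, hxy, splitEmb_fst]
  have h2 := congrArg Prod.snd hxy
  rcases x with v | i | i
  · rcases y with w | j | j
    · exact congrArg Sum.inl (Subtype.ext h1)
    · exact (v.2.1 h1).elim
    · exact (v.2.2 h1).elim
  · obtain ⟨j, rfl⟩ := (collapse_eq_left_iff hab).1 h1.symm
    rw [Fin.castSucc_injective 2 h2]
  · obtain ⟨j, rfl⟩ := (collapse_eq_right_iff hab).1 h1.symm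
    rw [Fin.castSucc_injective 2 h2]

theorem map_fst_map_splitEmb (e : Sym2 (SplitVertex a b)) :
    Sym2.map Prod.fst (Sym2.map splitEmb e) = Sym2.map collapse e := by
  rw [Sym2.map_map]
  congr 1
  exact funext splitEmb_fst

variable {G : SimpleGraph V} {𝒳 : Set (Set V)} {α β : V → Fin 2}

/-- At a copy of `a` or `b` the index is dictated by `α` or `β` at the other endpoint. Hence each
edge of `G` comes from a single edge of the split graph. -/
theorem eq_of_adj_of_collapse_eq (hab : a ≠ b) {x y x' y' : SplitVertex a b}
    (h : (splitGraph G a b α β).Adj x y) (h' : (splitGraph G a b α β).Adj x' y')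
    (hx : collapse x = collapse x') (hy : collapse y = collapse y') : x = x' := by
  have h1 := h.2.1
  have h1' := h'.2.1
  rw [← hy] at h1'
  rcases x with v | i | i
  · rcases x' with w | j | j
    · exact congrArg Sum.inl (Subtype.ext hx)
    · exact (v.2.1 hx).elim
    · exact (v.2.2 hx).elim
  · obtain ⟨j, rfl⟩ := (collapse_eq_left_iff hab).1 hx.symm
    have : i = j := h1.symm.trans h1'
    rw [this]
  · obtain ⟨j, rfl⟩ := (collapse_eq_right_iff hab).1 hx.symm
    have : i = j := h1.symm.trans h1'
    rw [this]

theorem injOn_map_collapse (hab : a ≠ b) :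
    Set.InjOn (Sym2.map collapse) (splitGraph G a b α β).edgeSet := by
  intro e he e' he' hee
  induction e with | _ x y =>
  induction e' with | _ x' y' =>
  rw [SimpleGraph.mem_edgeSet] at he he'
  rw [Sym2.map_mk, Sym2.map_mk] at hee
  rcases Sym2.eq_iff.1 hee with ⟨hx, hy⟩ | ⟨hx, hy⟩
  · rw [eq_of_adj_of_collapse_eq hab he he' hx hy,
      eq_of_adj_of_collapse_eq hab he.symm he'.symm hy hx]
  · rw [eq_of_adj_of_collapse_eq hab he he'.symm hx hy,
      eq_of_adj_of_collapse_eq hab he.symm he' hy hx, Sym2.eq_swap]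

theorem image_map_collapse_edgeSet :
    Sym2.map collapse '' (splitGraph G a b α β).edgeSet = G.edgeSet := by
  classical
  ext e
  constructor
  · rintro ⟨e, he, rfl⟩
    induction e with | _ x y =>
    exact he.1
  · induction e with | _ u v =>
    intro huv
    have h : ∀ u w : V, ∃ x : SplitVertex a b, collapse x = u ∧ Assigned α β x w := by
      intro u w
      by_cases ha : u = a
      · exact ⟨copyA (α w), ha.symm, rfl⟩
      by_cases hb : u = b
      · exact ⟨copyB (β w), hb.symm, rfl⟩
      exact ⟨Sum.inl ⟨u, ha, hb⟩, rfl, trivial⟩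
    obtain ⟨x, rfl, hx⟩ := h u v
    obtain ⟨y, rfl, hy⟩ := h v (collapse x)
    exact ⟨s(x, y), ⟨huv, hx, hy⟩, rfl⟩

theorem not_adj_of_mem_newVertices (hGab : ¬ G.Adj a b) {x y : SplitVertex a b}
    (hx : x ∈ newVertices a b) (hy : y ∈ newVertices a b) :
    ¬ (splitGraph G a b α β).Adj x y := by
  intro h
  have h1 := h.1
  rcases mem_newVertices_iff.1 hx with hx | hx <;> rcases mem_newVertices_iff.1 hy with hy | hy <;>
    rw [hx, hy] at h1
  · exact h1.ne rfl
  · exact hGab h1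
  · exact hGab h1.symm
  · exact h1.ne rfl

/-- The definition of the split cluster asks for an old neighbour; this is automatic, because new
vertices are pairwise nonadjacent. -/
theorem mem_splitCluster_of_adj (hGab : ¬ G.Adj a b) {X : Set V} {x y : SplitVertex a b}
    (h : (splitGraph G a b α β).Adj x y) (hx : collapse x ∈ X) (hy : collapse y ∈ X) :
    x ∈ splitCluster G a b α β X := by
  refine ⟨hx, fun hxn => ?_⟩
  rcases y with w | j
  · exact ⟨w, hy, h⟩
  · exact (not_adj_of_mem_newVertices hGab hxn ⟨j, rfl⟩ h).elim

open Classical in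
/-- The index of an element of `Z`; it is `2` if `Z` is empty. -/
noncomputable def copyIndex (Z : Set (SplitVertex a b)) : Fin 3 :=
  if h : Z.Nonempty then (splitEmb h.some).2 else 2

/-- The embedding of `V` into `V × Fin 3` that sends `a` to the copy of `a` in the cluster obtained
from `X`, and to `(a, 2)` if there is none, and the same for `b`. -/
noncomputable def clusterLift (G : SimpleGraph V) (a b : V) (α β : V → Fin 2) (X : Set V)
    (v : V) : V × Fin 3 :=
  (v, copyIndex (splitCluster G a b α β X ∩ collapse ⁻¹' {v}))

theorem clusterLift_injective (X : Set V) : Function.Injective (clusterLift G a b α β X) :=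
  fun _ _ h => congrArg Prod.fst h

theorem map_fst_map_clusterLift (X : Set V) (e : Sym2 V) :
    Sym2.map Prod.fst (Sym2.map (clusterLift G a b α β X) e) = e := by
  rw [Sym2.map_map]
  exact congrFun Sym2.map_id e

/-- When `collapse` is injective on the split cluster, the fibre over each vertex has at most one
element, so the arbitrary choice in `copyIndex` is forced. -/
theorem clusterLift_collapse {X : Set V} (hX : Set.InjOn collapse (splitCluster G a b α β X))
    {x : SplitVertex a b} (hx : x ∈ splitCluster G a b α β X) :
    clusterLift G a b α β X (collapse x) = splitEmb x := by
  have h : (splitCluster G a b α β X ∩ collapse ⁻¹' {collapse x}).Nonempty := ⟨x, hx, rfl⟩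
  have h1 : h.some = x := hX h.some_mem.1 hx h.some_mem.2
  rw [clusterLift, copyIndex, dif_pos h, h1]
  exact Prod.ext (splitEmb_fst x).symm rfl

theorem clusterLift_eq_of_inter_eq {X Y : Set V} {v : V}
    (h : splitCluster G a b α β X ∩ collapse ⁻¹' {v} =
      splitCluster G a b α β Y ∩ collapse ⁻¹' {v}) :
    clusterLift G a b α β X v = clusterLift G a b α β Y v := by
  rw [clusterLift, clusterLift, h]

theorem collapse_preimage_left (hab : a ≠ b) :
    (collapse ⁻¹' {a} : Set (SplitVertex a b)) = {copyA 0, copyA 1} := by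
  ext x
  rw [Set.mem_preimage, Set.mem_singleton_iff, collapse_eq_left_iff hab]
  simp [Fin.exists_fin_two]

theorem collapse_preimage_right (hab : a ≠ b) :
    (collapse ⁻¹' {b} : Set (SplitVertex a b)) = {copyB 0, copyB 1} := by
  ext x
  rw [Set.mem_preimage, Set.mem_singleton_iff, collapse_eq_right_iff hab]
  simp [Fin.exists_fin_two]

theorem splitCluster_inter_preimage {X : Set V} {v : V} (hv : v ∈ X) (ha : v ≠ a) (hb : v ≠ b) :
    splitCluster G a b α β X ∩ collapse ⁻¹' {v} = {Sum.inl ⟨v, ha, hb⟩} := by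
  ext x
  simp only [Set.mem_inter_iff, Set.mem_preimage, Set.mem_singleton_iff]
  constructor
  · rintro ⟨-, hx⟩
    rcases x with w | i | i
    · exact congrArg Sum.inl (Subtype.ext hx)
    · exact (ha hx.symm).elim
    · exact (hb hx.symm).elim
  · rintro rfl
    exact ⟨⟨hv, fun h => by simp [newVertices] at h⟩, rfl⟩

theorem ne_of_mk_mem_sharedSet (h : s(a, b) ∈ sharedSet 𝒳) : a ≠ b := by
  obtain ⟨u, v, huv, h, -⟩ := h
  rintro rfl
  have : Sym2.IsDiag s(u, v) := by rw [← h]; simp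
  exact huv (by simpa using this)

namespace IsSafeNonedgeSplit

theorem ne (h : IsSafeNonedgeSplit G 𝒳 a b α β) : a ≠ b := ne_of_mk_mem_sharedSet h.mem_sharedSet

theorem mk_notMem_edgeSet (h : IsSafeNonedgeSplit G 𝒳 a b α β) : s(a, b) ∉ G.edgeSet := h.not_adj

/-- Two different clusters through the shared nonedge `uv` meet exactly in it by 2-thinness, so
condition (ii) of safety applies and gives the same copy of `u` in both. -/
theorem clusterLift_eq [Finite V] (h : IsSafeNonedgeSplit G 𝒳 a b α β) (hcov : IsTwoThinCover G 𝒳)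
    {X Y : Set V} (hX : X ∈ 𝒳) (hY : Y ∈ 𝒳) {u v : V} (huv : s(u, v) ∈ sharedSet 𝒳)
    (hE : ¬ G.Adj u v) (hne : s(u, v) ≠ s(a, b)) (huX : u ∈ X) (hvX : v ∈ X) (huY : u ∈ Y)
    (hvY : v ∈ Y) : clusterLift G a b α β X u = clusterLift G a b α β Y u := by
  by_cases hXY : X = Y
  · rw [hXY]
  have huv' : u ≠ v := ne_of_mk_mem_sharedSet huv
  have hint : X ∩ Y = {u, v} := by
    refine (Set.eq_of_subset_of_ncard_le (s := {u, v}) (t := X ∩ Y)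
      (Set.pair_subset ⟨huX, huY⟩ ⟨hvX, hvY⟩) ?_).symm
    rw [Set.ncard_pair huv']
    exact hcov.inter_le X hX Y hY hXY
  apply clusterLift_eq_of_inter_eq
  by_cases ha : u = a
  · subst ha
    rw [collapse_preimage_left h.ne]
    exact h.same_copyA X hX Y hY v (fun hv => hne (by rw [hv])) huv hE hint
  by_cases hb : u = b
  · subst hb
    rw [collapse_preimage_right h.ne]
    exact h.same_copyB X hX Y hY v (fun hv => hne (by rw [hv, Sym2.eq_swap])) huv hE hint
  rw [splitCluster_inter_preimage huX ha hb, splitCluster_inter_preimage huY ha hb]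

end IsSafeNonedgeSplit

end Split

/-! ### Lifting the cover to `V × Fin 3` and the rank of the split graph with its key gluing pairs
-/

section LiftedCover

variable {V : Type*} {a b : V} {G : SimpleGraph V} {𝒳 : Set (Set V)} {α β : V → Fin 2}

/-- The edges of the split graph, as pairs of elements of `V × Fin 3`. -/
def liftedEdges (G : SimpleGraph V) (a b : V) (α β : V → Fin 2) : Set (Sym2 (V × Fin 3)) :=
  Sym2.map splitEmb '' (splitGraph G a b α β).edgeSet

/-- The lifts of the pairs in `S` that are contained in the cluster `X`. -/
def liftedPairs (G : SimpleGraph V) (a b : V) (α β : V → Fin 2) (S : Set (Sym2 V)) (X : Set V) :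
    Set (Sym2 (V × Fin 3)) :=
  {e ∈ liftedEdges G a b α β | Sym2.map Prod.fst e ∈ S ∩ pairsIn X} ∪
    Sym2.map (clusterLift G a b α β X) '' ((S \ G.edgeSet) ∩ pairsIn X)

theorem injOn_map_fst_liftedEdges (hab : a ≠ b) :
    Set.InjOn (Sym2.map Prod.fst) (liftedEdges G a b α β) := by
  rintro _ ⟨e, he, rfl⟩ _ ⟨e', he', rfl⟩ h
  rw [map_fst_map_splitEmb, map_fst_map_splitEmb] at h
  rw [injOn_map_collapse hab he he' h]

theorem map_fst_image_liftedEdges :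
    Sym2.map Prod.fst '' liftedEdges G a b α β = G.edgeSet := by
  rw [liftedEdges, Set.image_image, ← image_map_collapse_edgeSet (a := a) (b := b) (α := α) (β := β)]
  exact Set.image_congr fun e _ => map_fst_map_splitEmb e

theorem map_fst_mem_edgeSet {e : Sym2 (V × Fin 3)} (he : e ∈ liftedEdges G a b α β) :
    Sym2.map Prod.fst e ∈ G.edgeSet :=
  map_fst_image_liftedEdges.subset ⟨e, he, rfl⟩

theorem ncard_liftedEdges_sep (hab : a ≠ b) (F : Set (Sym2 V)) :
    {e ∈ liftedEdges G a b α β | Sym2.map Prod.fst e ∈ F}.ncard = (G.edgeSet ∩ F).ncard := by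
  rw [← map_fst_image_liftedEdges (a := a) (b := b) (α := α) (β := β), ← Set.image_inter_preimage,
    ((injOn_map_fst_liftedEdges hab).mono Set.inter_subset_left).ncard_image]
  rfl

theorem map_clusterLift_map_fst (hGab : ¬ G.Adj a b) {X : Set V}
    (hX : Set.InjOn collapse (splitCluster G a b α β X)) {e : Sym2 (V × Fin 3)}
    (he : e ∈ liftedEdges G a b α β) (heX : Sym2.map Prod.fst e ∈ pairsIn X) :
    Sym2.map (clusterLift G a b α β X) (Sym2.map Prod.fst e) = e := by
  obtain ⟨e, he, rfl⟩ := he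
  rw [map_fst_map_splitEmb] at heX ⊢
  induction e with | _ x y =>
  obtain ⟨-, hx, hy⟩ := mk_mem_pairsIn.1 heX
  rw [Sym2.map_mk, Sym2.map_mk, Sym2.map_mk,
    clusterLift_collapse hX (mem_splitCluster_of_adj hGab he hx hy),
    clusterLift_collapse hX (mem_splitCluster_of_adj hGab he.symm hy hx)]

theorem liftedEdges_sep_eq_image (hGab : ¬ G.Adj a b) {X : Set V}
    (hX : Set.InjOn collapse (splitCluster G a b α β X)) {F : Set (Sym2 V)} (hF : F ⊆ pairsIn X) :
    {e ∈ liftedEdges G a b α β | Sym2.map Prod.fst e ∈ F} =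
      Sym2.map (clusterLift G a b α β X) '' (G.edgeSet ∩ F) := by
  ext e
  constructor
  · rintro ⟨he, heF⟩
    exact ⟨_, ⟨map_fst_mem_edgeSet he, heF⟩, map_clusterLift_map_fst hGab hX he (hF heF)⟩
  · rintro ⟨e, ⟨heG, heF⟩, rfl⟩
    rw [← map_fst_image_liftedEdges (a := a) (b := b) (α := α) (β := β)] at heG
    obtain ⟨e, he, rfl⟩ := heG
    rw [map_clusterLift_map_fst hGab hX he (hF heF)]
    exact ⟨he, heF⟩

theorem indep_liftedEdges {κ : RigidityKind} [Finite V] (hab : a ≠ b)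
    (hGs : IsIndependent κ (splitGraph G a b α β)) :
    (rigidityMatroid κ (V × Fin 3)).Indep (liftedEdges G a b α β) :=
  (indep_image_map_iff (splitEmb_injective hab)).2 hGs

/-- Passing to the lift of a cluster does not increase its rank relative to the shared pairs. -/
theorem IsSafeNonedgeSplit.rk_lifted_add_ncard_le {κ : RigidityKind} [Finite V]
    (hG : IsIndependent κ G) (hS : (rigidityMatroid κ V).Indep (sharedSet 𝒳))
    (h : IsSafeNonedgeSplit G 𝒳 a b α β) (hGs : IsIndependent κ (splitGraph G a b α β))
    {X : Set V} (hX : X ∈ 𝒳) :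
    rk κ ({e ∈ liftedEdges G a b α β | Sym2.map Prod.fst e ∈ pairsIn X} ∪
        liftedPairs G a b α β (sharedSet 𝒳) X) + (sharedSet 𝒳 ∩ pairsIn X).ncard ≤
      rk κ ((G.edgeSet ∪ sharedSet 𝒳) ∩ pairsIn X) +
        rk κ (liftedPairs G a b α β (sharedSet 𝒳) X) := by
  set S := sharedSet 𝒳 with hSdef
  -- If `X` contains a shared nonedge, safety makes `clusterLift` an embedding that carries the
  -- whole cluster, and ranks are preserved. Otherwise all shared pairs in `X` are edges, and
  -- independence of both graphs reduces the claim to counting.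
  by_cases hex : ∃ e ∈ S, e ∉ G.edgeSet ∧ e ∈ pairsIn X
  · have hinj := injOn_collapse h.ne (h.not_both X hX hex)
    have h1 : liftedPairs G a b α β S X = Sym2.map (clusterLift G a b α β X) '' (S ∩ pairsIn X) := by
      rw [liftedPairs, liftedEdges_sep_eq_image h.not_adj hinj Set.inter_subset_right,
        ← Set.image_union]
      congr 1
      ext e
      by_cases he : e ∈ G.edgeSet <;> simp [he]
    rw [h1, liftedEdges_sep_eq_image h.not_adj hinj subset_rfl, ← Set.image_union,
      rk_image_map (clusterLift_injective X), rk_image_map (clusterLift_injective X),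
      ← Set.union_inter_distrib_right, rk_eq_ncard (hS.subset Set.inter_subset_left)]
  · have h1 : S ∩ pairsIn X ⊆ G.edgeSet := by
      intro e he
      by_contra hn
      exact hex ⟨e, he.1, hn, he.2⟩
    have h2 : (S \ G.edgeSet) ∩ pairsIn X = ∅ := by
      rw [Set.eq_empty_iff_forall_notMem]
      rintro e ⟨⟨he, hn⟩, heX⟩
      exact hn (h1 ⟨he, heX⟩)
    have h3 : liftedPairs G a b α β S X ⊆
        {e ∈ liftedEdges G a b α β | Sym2.map Prod.fst e ∈ pairsIn X} := by
      rw [liftedPairs, h2, Set.image_empty, Set.union_empty]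
      exact fun e he => ⟨he.1, he.2.2⟩
    have h4 : (liftedPairs G a b α β S X).ncard = (S ∩ pairsIn X).ncard := by
      rw [liftedPairs, h2, Set.image_empty, Set.union_empty, ncard_liftedEdges_sep h.ne,
        Set.inter_eq_right.2 h1]
    have h5 : (G.edgeSet ∪ S) ∩ pairsIn X = G.edgeSet ∩ pairsIn X := by
      rw [Set.union_inter_distrib_right, Set.union_eq_left]
      exact fun e he => ⟨h1 he, he.2⟩
    have hind := indep_liftedEdges h.ne hGs
    rw [Set.union_eq_left.2 h3, h5, rk_eq_ncard (hG.subset Set.inter_subset_left),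
      rk_eq_ncard (hind.subset (h3.trans (Set.sep_subset _ _))), h4]
    refine Nat.add_le_add_right ((rk_le_ncard _).trans ?_) _
    rw [ncard_liftedEdges_sep h.ne]

variable (G 𝒳 a b α β) in
/-- The lifts of the shared pairs. -/
def liftedShared : Set (Sym2 (V × Fin 3)) := ⋃ X ∈ 𝒳, liftedPairs G a b α β (sharedSet 𝒳) X

theorem mem_liftedShared {e : Sym2 (V × Fin 3)} (he : e ∈ liftedShared a b G 𝒳 α β) :
    Sym2.map Prod.fst e ∈ sharedSet 𝒳 ∧ (e ∈ liftedEdges G a b α β ∨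
      Sym2.map Prod.fst e ∉ G.edgeSet ∧ ∃ X ∈ 𝒳, Sym2.map Prod.fst e ∈ pairsIn X ∧
        Sym2.map (clusterLift G a b α β X) (Sym2.map Prod.fst e) = e) := by
  simp only [liftedShared, Set.mem_iUnion] at he
  obtain ⟨X, hX, ⟨he, heX⟩ | ⟨e, ⟨⟨heS, heE⟩, heX⟩, rfl⟩⟩ := he
  · exact ⟨heX.1, Or.inl he⟩
  · rw [map_fst_map_clusterLift]
    exact ⟨heS, Or.inr ⟨heE, X, hX, heX, rfl⟩⟩

/-- Shared pairs other than `ab` have at most one lift. -/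
theorem IsSafeNonedgeSplit.eq_of_map_fst_eq [Finite V] (h : IsSafeNonedgeSplit G 𝒳 a b α β)
    (hcov : IsTwoThinCover G 𝒳) {e e' : Sym2 (V × Fin 3)} (he : e ∈ liftedShared a b G 𝒳 α β)
    (he' : e' ∈ liftedShared a b G 𝒳 α β) (hne : Sym2.map Prod.fst e ≠ s(a, b))
    (hee : Sym2.map Prod.fst e = Sym2.map Prod.fst e') : e = e' := by
  obtain ⟨heS, he⟩ := mem_liftedShared he
  obtain ⟨-, he'⟩ := mem_liftedShared he'
  rcases he with he | ⟨hn, X, hX, heX, he⟩ <;> rcases he' with he' | ⟨hn', X', hX', heX', he'⟩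
  · exact injOn_map_fst_liftedEdges h.ne he he' hee
  · exact (hn' (hee ▸ map_fst_mem_edgeSet he)).elim
  · exact (hn (hee ▸ map_fst_mem_edgeSet he')).elim
  · rw [← he, ← he', ← hee]
    rw [← hee] at heX'
    generalize Sym2.map Prod.fst e = f at *
    induction f with | _ u v =>
    obtain ⟨-, huX, hvX⟩ := mk_mem_pairsIn.1 heX
    obtain ⟨-, huX', hvX'⟩ := mk_mem_pairsIn.1 heX'
    rw [Sym2.map_mk, Sym2.map_mk, h.clusterLift_eq hcov hX hX' heS hn hne huX hvX huX' hvX',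
      h.clusterLift_eq hcov hX hX' (u := v) (v := u) (by rwa [Sym2.eq_swap])
      (fun h => hn h.symm) (by rwa [Sym2.eq_swap]) hvX huX hvX' huX']

/-- Shared pairs other than `ab` lift at most once, so only `ab` can contribute several lifts; the 1
accounts for `ab` itself in the shared set. -/
theorem IsSafeNonedgeSplit.ncard_liftedShared_add_ncard_le [Finite V]
    (h : IsSafeNonedgeSplit G 𝒳 a b α β) (hcov : IsTwoThinCover G 𝒳) :
    (liftedShared a b G 𝒳 α β).ncard + 1 ≤ (sharedSet 𝒳).ncard +
      {e ∈ liftedShared a b G 𝒳 α β | Sym2.map Prod.fst e = s(a, b)}.ncard := by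
  have h1 : {e ∈ liftedShared a b G 𝒳 α β | Sym2.map Prod.fst e ≠ s(a, b)}.ncard ≤
      (sharedSet 𝒳 \ {s(a, b)}).ncard :=
    Set.ncard_le_ncard_of_injOn (Sym2.map Prod.fst)
      (fun e he => ⟨(mem_liftedShared he.1).1, he.2⟩)
      (fun e he e' he' hee => h.eq_of_map_fst_eq hcov he.1 he'.1 he.2 hee) (Set.toFinite _)
  have h2 := Set.ncard_sdiff_singleton_add_one h.mem_sharedSet (Set.toFinite _)
  have h3 : liftedShared a b G 𝒳 α β ⊆
      {e ∈ liftedShared a b G 𝒳 α β | Sym2.map Prod.fst e ≠ s(a, b)} ∪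
      {e ∈ liftedShared a b G 𝒳 α β | Sym2.map Prod.fst e = s(a, b)} := by
    intro e he
    by_cases hn : Sym2.map Prod.fst e = s(a, b)
    · exact Or.inr ⟨he, hn⟩
    · exact Or.inl ⟨he, hn⟩
  have h4 := (Set.ncard_le_ncard h3 (Set.toFinite _)).trans (Set.ncard_union_le _ _)
  omega

/-- Clusterwise submodularity upstairs, with each relative rank bounded by its value in `G`; the
assumed rank formula evaluates the sum of these values as |E(G)| - |S|. -/
theorem IsSafeNonedgeSplit.rk_liftedEdges_union_liftedShared {κ : RigidityKind} [Finite V]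
    (hbase : IsSafeBase κ G 𝒳) (h : IsSafeNonedgeSplit G 𝒳 a b α β)
    (hGs : IsIndependent κ (splitGraph G a b α β)) :
    rk κ (liftedEdges G a b α β ∪ liftedShared a b G 𝒳 α β) + (sharedSet 𝒳).ncard ≤
      (liftedShared a b G 𝒳 α β).ncard + G.edgeSet.ncard := by
  have hrank := hbase.rank_eq
  have hfin : ∃ 𝒵 : Finset (Set V), ∀ X, X ∈ 𝒵 ↔ X ∈ 𝒳 :=
    ⟨(Set.toFinite 𝒳).toFinset, fun X => by simp⟩
  obtain ⟨𝒵, h𝒵⟩ := hfin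
  have h𝒵' : (𝒵 : Set (Set V)) = 𝒳 := Set.ext h𝒵
  have hcount := rankCount_eq κ G 𝒵 fun e he => hbase.shared_indep.subset_ground he
  rw [h𝒵'] at hcount
  rw [hcount, rk_eq_ncard hbase.independent] at hrank
  have h1 := rk_union_biUnion_add_sum_le (κ := κ) 𝒵 (liftedShared a b G 𝒳 α β)
    (fun X => {e ∈ liftedEdges G a b α β | Sym2.map Prod.fst e ∈ pairsIn X})
    (fun X => liftedPairs G a b α β (sharedSet 𝒳) X)
    (fun X hX => Set.subset_biUnion_of_mem (u := fun X => liftedPairs G a b α β (sharedSet 𝒳) X)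
      ((h𝒵 X).1 hX))
  have h2 := Finset.sum_le_sum fun X hX =>
    h.rk_lifted_add_ncard_le hbase.independent hbase.shared_indep hGs ((h𝒵 X).1 hX)
  rw [Finset.sum_add_distrib, Finset.sum_add_distrib] at h2
  have h3 : rk κ (liftedEdges G a b α β ∪ liftedShared a b G 𝒳 α β) ≤
      rk κ (liftedShared a b G 𝒳 α β ∪
        ⋃ X ∈ 𝒵, {e ∈ liftedEdges G a b α β | Sym2.map Prod.fst e ∈ pairsIn X}) := by
    refine rk_mono (Set.union_subset (fun e he => Or.inr ?_) Set.subset_union_left)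
    obtain ⟨X, hX, heX⟩ := hbase.cover.covers _ (map_fst_mem_edgeSet he)
    exact Set.mem_biUnion ((h𝒵 X).2 hX) ⟨he, heX⟩
  have h4 := rk_le_ncard (κ := κ) (liftedShared a b G 𝒳 α β)
  omega

theorem IsSafeNonedgeSplit.mem_lifts_iff (h : IsSafeNonedgeSplit G 𝒳 a b α β)
    {e : Sym2 (V × Fin 3)} :
    e ∈ liftedShared a b G 𝒳 α β ∧ Sym2.map Prod.fst e = s(a, b) ↔
      ∃ X ∈ 𝒳, a ∈ X ∧ b ∈ X ∧ e = s(clusterLift G a b α β X a, clusterLift G a b α β X b) := by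
  constructor
  · rintro ⟨he, hee⟩
    obtain ⟨-, he⟩ := mem_liftedShared he
    rw [hee] at he
    rcases he with he | ⟨-, X, hX, heX, he⟩
    · exact (h.mk_notMem_edgeSet (hee ▸ map_fst_mem_edgeSet he)).elim
    · obtain ⟨-, ha, hb⟩ := mk_mem_pairsIn.1 heX
      exact ⟨X, hX, ha, hb, he.symm⟩
  · rintro ⟨X, hX, ha, hb, rfl⟩
    refine ⟨?_, rfl⟩
    refine Set.mem_biUnion hX (Or.inr ⟨s(a, b), ⟨⟨h.mem_sharedSet, h.mk_notMem_edgeSet⟩, ?_⟩, rfl⟩)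
    exact mk_mem_pairsIn.2 ⟨h.ne, ha, hb⟩

theorem IsSafeNonedgeSplit.injOn_collapse (h : IsSafeNonedgeSplit G 𝒳 a b α β) {X : Set V}
    (hX : X ∈ 𝒳) (ha : a ∈ X) (hb : b ∈ X) : Set.InjOn collapse (splitCluster G a b α β X) :=
  SplitGlue.injOn_collapse h.ne (h.not_both X hX
    ⟨_, h.mem_sharedSet, h.mk_notMem_edgeSet, mk_mem_pairsIn.2 ⟨h.ne, ha, hb⟩⟩)

/-- The lifts of `ab` between copies of `a` and `b` are the key gluing pairs. -/
theorem IsSafeNonedgeSplit.image_keyPairs [Finite V] (h : IsSafeNonedgeSplit G 𝒳 a b α β) :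
    Sym2.map splitEmb '' keyPairs (safeSplitCover G 𝒳 a b α β) (newVertices a b) =
      {e | (e ∈ liftedShared a b G 𝒳 α β ∧ Sym2.map Prod.fst e = s(a, b)) ∧
        (a, 2) ∉ e ∧ (b, 2) ∉ e} := by
  ext e
  constructor
  · rintro ⟨e, ⟨hnew, Z, hZ, heZ⟩, rfl⟩
    have hn2 : ∀ v : V, (v, (2 : Fin 3)) ∉ Sym2.map splitEmb e := by
      intro v hv
      obtain ⟨x, -, hx⟩ := Sym2.mem_map.1 hv
      exact splitEmb_snd_ne x (by rw [hx])
    refine ⟨h.mem_lifts_iff.2 ?_, hn2 a, hn2 b⟩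
    clear hn2
    induction e with | _ x y =>
    obtain ⟨hxy, hx, hy⟩ := mk_mem_pairsIn.1 hnew
    obtain ⟨-, hxZ, hyZ⟩ := mk_mem_pairsIn.1 heZ
    rcases hZ with ⟨⟨X, hX, rfl⟩, -, hZ⟩ | ⟨⟨x', y', hadj, rfl⟩, -⟩
    · have hinj := SplitGlue.injOn_collapse h.ne hZ
      have hne : collapse x ≠ collapse y := fun h => hxy (hinj hxZ hyZ h)
      have key : ∀ x y : SplitVertex a b, x ∈ splitCluster G a b α β X →
          y ∈ splitCluster G a b α β X → collapse x = a → collapse y = b →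
          ∃ X ∈ 𝒳, a ∈ X ∧ b ∈ X ∧ s(splitEmb x, splitEmb y) =
            s(clusterLift G a b α β X a, clusterLift G a b α β X b) := by
        intro x y hx hy hxa hyb
        refine ⟨X, hX, hxa ▸ hx.1, hyb ▸ hy.1, ?_⟩
        rw [← clusterLift_collapse hinj hx, ← clusterLift_collapse hinj hy, hxa, hyb]
      rcases mem_newVertices_iff.1 hx with hxa | hxb <;>
        rcases mem_newVertices_iff.1 hy with hya | hyb
      · exact (hne (hxa.trans hya.symm)).elim
      · exact key x y hxZ hyZ hxa hyb
      · rw [Sym2.map_mk, Sym2.eq_swap]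
        exact key y x hyZ hxZ hya hxb
      · exact (hne (hxb.trans hyb.symm)).elim
    -- A two-element cluster is an edge of the split graph, so it cannot be a pair of new vertices.
    · refine (not_adj_of_mem_newVertices h.not_adj ?_ ?_ hadj).elim
      all_goals
        simp only [Set.mem_insert_iff, Set.mem_singleton_iff] at hxZ hyZ
        rcases hxZ with rfl | rfl <;> rcases hyZ with rfl | rfl <;>
          first | assumption | exact (hxy rfl).elim
  · rintro ⟨he, hea, heb⟩
    obtain ⟨X, hX, ha, hb, rfl⟩ := h.mem_lifts_iff.1 he
    have hinj := h.injOn_collapse hX ha hb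
    have key : ∀ v, (v, (2 : Fin 3)) ≠ clusterLift G a b α β X v →
        ∃ x ∈ splitCluster G a b α β X, collapse x = v := by
      intro v hv
      by_contra hn
      have hn' : ¬ (splitCluster G a b α β X ∩ collapse ⁻¹' {v}).Nonempty :=
        fun ⟨x, hx, hxv⟩ => hn ⟨x, hx, hxv⟩
      apply hv
      rw [clusterLift, copyIndex, dif_neg hn']
    obtain ⟨x, hxX, hxa⟩ := key a fun h => hea (by rw [h]; simp)
    obtain ⟨y, hyX, hyb⟩ := key b fun h => heb (by rw [h]; simp)
    have hx := mem_newVertices_iff.2 (Or.inl hxa)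
    have hy := mem_newVertices_iff.2 (Or.inr hyb)
    have hxy : x ≠ y := fun hxy => h.ne (by rw [← hxa, hxy, hyb])
    refine ⟨s(x, y), ⟨mk_mem_pairsIn.2 ⟨hxy, hx, hy⟩, _, Or.inl ⟨⟨X, hX, rfl⟩, ?_, ?_⟩,
      mk_mem_pairsIn.2 ⟨hxy, hxX, hyX⟩⟩, ?_⟩
    -- A copy enters the split cluster only with an old neighbour `w` in `X`, and `w` is the third
    -- vertex that makes the cluster big.
    · obtain ⟨w, hwX, hadj⟩ := hxX.2 hx
      have hw : (Sum.inl w : SplitVertex a b) ∈ splitCluster G a b α β X :=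
        mem_splitCluster_of_adj h.not_adj hadj.symm hwX hxX.1
      rw [Set.two_lt_ncard_iff]
      refine ⟨x, y, _, hxX, hyX, hw, hxy, ?_, ?_⟩
      · rintro rfl; exact w.2.1 hxa
      · rintro rfl; exact w.2.2 hyb
    · exact h.not_both X hX
        ⟨_, h.mem_sharedSet, h.mk_notMem_edgeSet, mk_mem_pairsIn.2 ⟨h.ne, ha, hb⟩⟩
    · rw [Sym2.map_mk, ← clusterLift_collapse hinj hxX, ← clusterLift_collapse hinj hyX, hxa, hyb]

/-- The key gluing pairs are dependent over the split graph. The bound first holds with all lifts of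
`ab` in place of the key pairs; deleting the lifts at the two dummy vertices then lowers rank and
cardinality equally. -/
theorem IsSafeBase.rk_splitGraph_union_keyPairs {κ : RigidityKind} [Finite V]
    (hbase : IsSafeBase κ G 𝒳) (h : IsSafeNonedgeSplit G 𝒳 a b α β)
    (hGs : IsIndependent κ (splitGraph G a b α β)) :
    rk κ ((splitGraph G a b α β).edgeSet ∪
        keyPairs (safeSplitCover G 𝒳 a b α β) (newVertices a b)) + 1 ≤
      (splitGraph G a b α β).edgeSet.ncard +
        (keyPairs (safeSplitCover G 𝒳 a b α β) (newVertices a b)).ncard := by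
  have hinj := splitEmb_injective h.ne
  rw [← rk_image_map hinj, Set.image_union,
    ← Set.ncard_image_of_injective (keyPairs _ _) (Sym2.map.injective hinj), h.image_keyPairs,
    ← (injOn_map_collapse h.ne).ncard_image, image_map_collapse_edgeSet]
  change rk κ (liftedEdges G a b α β ∪ _) + 1 ≤ _
  set F := {e | e ∈ liftedShared a b G 𝒳 α β ∧ Sym2.map Prod.fst e = s(a, b)} with hF
  set F₀ := {e | e ∈ F ∧ (a, (2 : Fin 3)) ∉ e ∧ (b, (2 : Fin 3)) ∉ e} with hF₀
  change rk κ (liftedEdges G a b α β ∪ F₀) + 1 ≤ G.edgeSet.ncard + F₀.ncard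
  -- The condition `x.2 ≠ 2` assigns the pair of the two dummies to `B` alone and keeps `(a, 2)` out
  -- of the first star, as needed when `(a, 2)` is added as a new vertex.
  set A := {x : V × Fin 3 | x.1 = a ∧ x.2 ≠ 2 ∧ s((b, 2), x) ∈ F} with hA
  set B := {x : V × Fin 3 | x.1 = b ∧ s((a, 2), x) ∈ F} with hB
  -- Each vertex of `V` has only three copies in `V × Fin 3`, so both dummies have degree at most
  -- three.
  have hcard : ∀ (v : V) (U : Set (V × Fin 3)), (∀ x ∈ U, x.1 = v) → U.ncard ≤ 3 := by
    intro v U hU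
    have := Set.ncard_le_ncard_of_injOn (s := U) (t := (Set.univ : Set (Fin 3))) Prod.snd
      (fun _ _ => trivial) (fun x hx y hy hxy => Prod.ext ((hU x hx).trans (hU y hy).symm) hxy)
    simpa [Set.ncard_univ] using this
  have hlift : ∀ (v : V), ∀ e ∈ liftedEdges G a b α β, (v, (2 : Fin 3)) ∉ e := by
    rintro v _ ⟨e, -, rfl⟩ hv
    obtain ⟨x, -, hx⟩ := Sym2.mem_map.1 hv
    exact splitEmb_snd_ne x (by rw [hx])
  have hab := h.ne
  have h1 : rk κ (liftedEdges G a b α β ∪ F₀) + A.ncard ≤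
      rk κ (liftedEdges G a b α β ∪ F₀ ∪ star (b, 2) A) := by
    refine rk_add_ncard_le_rk_union_star ?_ (fun h => hab h.1.symm) (hcard a A fun x hx => hx.1)
    rintro e (he | he)
    · exact hlift b e he
    · exact he.2.2
  have h2 : rk κ (liftedEdges G a b α β ∪ F₀ ∪ star (b, 2) A) + B.ncard ≤
      rk κ (liftedEdges G a b α β ∪ F₀ ∪ star (b, 2) A ∪ star (a, 2) B) := by
    refine rk_add_ncard_le_rk_union_star ?_ (fun h => hab h.1) (hcard b B fun x hx => hx.1)
    rintro e ((he | he) | ⟨x, hx, rfl⟩)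
    · exact hlift a e he
    · exact he.2.1
    · intro hmem
      rcases Sym2.mem_iff.1 hmem with hm | hm
      · exact hab (congrArg Prod.fst hm)
      · exact hx.2.1 (by rw [← hm])
  have h3 : F ⊆ F₀ ∪ star (b, 2) A ∪ star (a, 2) B := by
    intro e he
    obtain ⟨X, hX, -, -, hee⟩ := h.mem_lifts_iff.1 he
    have hσa : (clusterLift G a b α β X a).1 = a := rfl
    have hσb : (clusterLift G a b α β X b).1 = b := rfl
    generalize clusterLift G a b α β X a = x at *
    generalize clusterLift G a b α β X b = y at *
    subst hee
    by_cases hx : x.2 = 2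
    · have : x = (a, 2) := Prod.ext hσa hx
      subst this
      exact Or.inr ⟨y, ⟨hσb, he⟩, rfl⟩
    by_cases hy : y.2 = 2
    · have : y = (b, 2) := Prod.ext hσb hy
      subst this
      exact Or.inl (Or.inr ⟨x, ⟨hσa, hx, by rwa [Sym2.eq_swap]⟩, Sym2.eq_swap⟩)
    refine Or.inl (Or.inl ⟨he, ?_, ?_⟩)
    · intro hm
      rcases Sym2.mem_iff.1 hm with rfl | rfl
      · exact hx rfl
      · exact hy rfl
    · intro hm
      rcases Sym2.mem_iff.1 hm with rfl | rfl
      · exact hx rfl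
      · exact hy rfl
  have h4 : F.ncard ≤ F₀.ncard + A.ncard + B.ncard := by
    rw [← ncard_star (b, (2 : Fin 3)) A, ← ncard_star (a, (2 : Fin 3)) B]
    exact (Set.ncard_le_ncard h3 (Set.toFinite _)).trans ((Set.ncard_union_le _ _).trans
      (Nat.add_le_add_right (Set.ncard_union_le _ _) _))
  have h5 : rk κ (liftedEdges G a b α β ∪ F₀ ∪ star (b, 2) A ∪ star (a, 2) B) ≤
      rk κ (liftedEdges G a b α β ∪ liftedShared a b G 𝒳 α β) := by
    apply rk_mono
    rintro e (((he | he) | ⟨x, hx, rfl⟩) | ⟨x, hx, rfl⟩)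
    · exact Or.inl he
    · exact Or.inr he.1.1
    · exact Or.inr hx.2.2.1
    · exact Or.inr hx.2.1
  have h6 := h.rk_liftedEdges_union_liftedShared hbase hGs
  have h7 := h.ncard_liftedShared_add_ncard_le hbase.cover
  change _ ≤ _ + F.ncard at h7
  omega

end LiftedCover

/-! ### Gluing -/

section Glue

variable {V U : Type*} {G : SimpleGraph V} {H : SimpleGraph U} {P : Set V} {Q : Set U} {φ : Q ≃ P}

theorem glueRight_of_mem {u : U} (h : u ∈ Q) : glueRight φ u = Sum.inl (φ ⟨u, h⟩ : V) :=
  dif_pos h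

theorem glueRight_of_notMem {u : U} (h : u ∉ Q) : glueRight φ u = Sum.inr ⟨u, h⟩ :=
  dif_neg h

theorem glueRight_injective (φ : Q ≃ P) : Function.Injective (glueRight φ) := by
  intro u v h
  by_cases hu : u ∈ Q <;> by_cases hv : v ∈ Q
  · rw [glueRight_of_mem hu, glueRight_of_mem hv] at h
    exact congrArg Subtype.val (φ.injective (Subtype.ext (Sum.inl_injective h)))
  · rw [glueRight_of_mem hu, glueRight_of_notMem hv] at h
    exact (Sum.inl_ne_inr h).elim
  · rw [glueRight_of_notMem hu, glueRight_of_mem hv] at h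
    exact (Sum.inr_ne_inl h).elim
  · rw [glueRight_of_notMem hu, glueRight_of_notMem hv] at h
    exact congrArg Subtype.val (Sum.inr_injective h)

theorem glueRight_eq_inl_iff {u : U} {v : V} :
    glueRight φ u = Sum.inl v ↔ ∃ h : u ∈ Q, (φ ⟨u, h⟩ : V) = v := by
  constructor
  · intro h
    by_cases hu : u ∈ Q
    · rw [glueRight_of_mem hu] at h
      exact ⟨hu, Sum.inl_injective h⟩
    · rw [glueRight_of_notMem hu] at h
      exact (Sum.inr_ne_inl h).elim
  · rintro ⟨h, rfl⟩
    exact glueRight_of_mem h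

theorem edgeSet_map_of_injective {W : Type*} {f : V → W} (hf : Function.Injective f)
    (G : SimpleGraph V) : (G.map f).edgeSet = Sym2.map f '' G.edgeSet :=
  SimpleGraph.edgeSet_map ⟨f, hf⟩ G

theorem edgeSet_glue (φ : Q ≃ P) : (glue G H φ).edgeSet =
    Sym2.map Sum.inl '' G.edgeSet ∪ Sym2.map (glueRight φ) '' H.edgeSet := by
  rw [glue, SimpleGraph.edgeSet_sup, edgeSet_map_of_injective Sum.inl_injective,
    edgeSet_map_of_injective (glueRight_injective φ)]

/-- An edge coming from both sides would join two gluing vertices of `H`, which are nonadjacent. -/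
theorem disjoint_edgeSet_glue (hQ : ∀ x ∈ Q, ∀ y ∈ Q, ¬ H.Adj x y) (φ : Q ≃ P) :
    Disjoint (Sym2.map Sum.inl '' G.edgeSet) (Sym2.map (glueRight φ) '' H.edgeSet) := by
  rw [Set.disjoint_left]
  rintro _ ⟨e, -, rfl⟩ ⟨e', he', h⟩
  have key : ∀ u ∈ e', u ∈ Q := by
    intro u hu
    have h1 : glueRight φ u ∈ Sym2.map Sum.inl e := h ▸ Sym2.mem_map.2 ⟨u, hu, rfl⟩
    obtain ⟨v, -, hv⟩ := Sym2.mem_map.1 h1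
    exact (glueRight_eq_inl_iff.1 hv.symm).1
  induction e' with | _ u v =>
  exact hQ u (key u (by simp)) v (key v (by simp)) he'

/-- The inclusion of the first graph into the glued graph. -/
def glueInl (G : SimpleGraph V) (H : SimpleGraph U) (φ : Q ≃ P) : G →g glue G H φ where
  toFun := Sum.inl
  map_rel' h := Or.inl ⟨Sum.inl_injective.ne h.ne, _, _, h, rfl, rfl⟩

/-- The map of the second graph into the glued graph. -/
noncomputable def glueInr (G : SimpleGraph V) (H : SimpleGraph U) (φ : Q ≃ P) :
    H →g glue G H φ where
  toFun := glueRight φ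
  map_rel' h := Or.inr ⟨(glueRight_injective φ).ne h.ne, _, _, h, rfl, rfl⟩

theorem ncard_edgeSet_subgraph_glue_le [Finite V] [Finite U] (N : (glue G H φ).Subgraph) :
    N.edgeSet.ncard ≤ (N.comap (glueInl G H φ)).edgeSet.ncard +
      (N.comap (glueInr G H φ)).edgeSet.ncard := by
  rw [← Set.ncard_image_of_injective (N.comap (glueInl G H φ)).edgeSet
      (Sym2.map.injective Sum.inl_injective),
    ← Set.ncard_image_of_injective (N.comap (glueInr G H φ)).edgeSet
      (Sym2.map.injective (glueRight_injective φ))]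
  refine (Set.ncard_le_ncard ?_ (Set.toFinite _)).trans (Set.ncard_union_le _ _)
  intro e he
  have h := N.edgeSet_subset he
  rw [edgeSet_glue] at h
  rcases h with ⟨e, heG, rfl⟩ | ⟨e, heG, rfl⟩
  · refine Or.inl ⟨e, ?_, rfl⟩
    induction e with | _ x y => exact ⟨heG, he⟩
  · refine Or.inr ⟨e, ?_, rfl⟩
    induction e with | _ x y => exact ⟨heG, he⟩

theorem image_comap_verts_inter (N : (glue G H φ).Subgraph) :
    Sum.inl '' ((N.comap (glueInl G H φ)).verts ∩ P) =
      glueRight φ '' ((N.comap (glueInr G H φ)).verts ∩ Q) := by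
  ext w
  constructor
  · rintro ⟨x, ⟨hx, hxP⟩, rfl⟩
    have h : glueRight φ (φ.symm ⟨x, hxP⟩ : U) = Sum.inl x :=
      glueRight_eq_inl_iff.2 ⟨(φ.symm ⟨x, hxP⟩).2, by simp⟩
    refine ⟨_, ⟨?_, (φ.symm ⟨x, hxP⟩).2⟩, h⟩
    change glueRight φ _ ∈ N.verts
    rw [h]
    exact hx
  · rintro ⟨u, ⟨hu, huQ⟩, rfl⟩
    rw [glueRight_of_mem huQ]
    refine ⟨_, ⟨?_, (φ ⟨u, huQ⟩).2⟩, rfl⟩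
    change glueRight φ u ∈ N.verts at hu
    rwa [glueRight_of_mem huQ] at hu

theorem ncard_comap_verts_inter (N : (glue G H φ).Subgraph) :
    ((N.comap (glueInr G H φ)).verts ∩ Q).ncard = ((N.comap (glueInl G H φ)).verts ∩ P).ncard := by
  rw [← Set.ncard_image_of_injective _ (glueRight_injective φ), ← image_comap_verts_inter,
    Set.ncard_image_of_injective _ Sum.inl_injective]

theorem ncard_comap_verts_add [Finite V] [Finite U]
    (N : (glue G H φ).Subgraph) :
    (N.comap (glueInl G H φ)).verts.ncard + (N.comap (glueInr G H φ)).verts.ncard =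
      N.verts.ncard + ((N.comap (glueInl G H φ)).verts ∩ P).ncard := by
  have h1 : Sum.inl '' (N.comap (glueInl G H φ)).verts ∪
      glueRight φ '' (N.comap (glueInr G H φ)).verts = N.verts := by
    ext w
    constructor
    · rintro (⟨x, hx, rfl⟩ | ⟨x, hx, rfl⟩) <;> exact hx
    · intro hw
      rcases w with x | u
      · exact Or.inl ⟨x, hw, rfl⟩
      · refine Or.inr ⟨u, ?_, glueRight_of_notMem u.2⟩
        change glueRight φ u ∈ N.verts
        rwa [glueRight_of_notMem u.2]
  have h2 : Sum.inl '' (N.comap (glueInl G H φ)).verts ∩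
      glueRight φ '' (N.comap (glueInr G H φ)).verts =
      Sum.inl '' ((N.comap (glueInl G H φ)).verts ∩ P) := by
    ext w
    constructor
    · rintro ⟨⟨x, hx, rfl⟩, ⟨u, hu, hux⟩⟩
      obtain ⟨huQ, rfl⟩ := glueRight_eq_inl_iff.1 hux
      exact ⟨_, ⟨hx, (φ ⟨u, huQ⟩).2⟩, rfl⟩
    · intro hw
      refine ⟨Set.image_mono Set.inter_subset_left hw, ?_⟩
      rw [image_comap_verts_inter] at hw
      exact Set.image_mono Set.inter_subset_left hw
  have h3 := Set.ncard_union_add_ncard_inter (Sum.inl '' (N.comap (glueInl G H φ)).verts)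
    (glueRight φ '' (N.comap (glueInr G H φ)).verts)
  rw [h1, h2, Set.ncard_image_of_injective _ Sum.inl_injective,
    Set.ncard_image_of_injective _ Sum.inl_injective,
    Set.ncard_image_of_injective _ (glueRight_injective φ)] at h3
  exact h3.symm

end Glue

/-! ### Edge counts of subgraphs -/

section Count

variable {V : Type*} {G : SimpleGraph V}

theorem edgeSet_subset_pairsIn (N : G.Subgraph) : N.edgeSet ⊆ pairsIn N.verts := by
  intro e he
  refine ⟨G.not_isDiag_of_mem_edgeSet (N.edgeSet_subset he), fun v hv => ?_⟩
  exact N.mem_verts_of_mem_edge he hv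

theorem ncard_pair_le_two {γ : Type*} (x y : γ) : ({x, y} : Set γ).ncard ≤ 2 :=
  (Set.ncard_insert_le x {y}).trans (by rw [Set.ncard_singleton])

variable {κ : RigidityKind} [Finite V]

theorem ncard_le_choose {D : Set (Sym2 V)} {X : Set V} (hD : D ⊆ pairsIn X) :
    D.ncard ≤ X.ncard.choose 2 :=
  (Set.ncard_le_ncard hD (Set.toFinite _)).trans (ncard_pairsIn X).le

theorem ncard_lt_choose {D : Set (Sym2 V)} {X : Set V} (hD : D ⊆ pairsIn X) {x y : V}
    (hxy : x ≠ y) (hx : x ∈ X) (hy : y ∈ X) (h : s(x, y) ∉ D) : D.ncard < X.ncard.choose 2 := by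
  rw [← ncard_pairsIn]
  refine Set.ncard_lt_ncard ⟨hD, fun hle => h (hle ?_)⟩ (Set.toFinite _)
  exact mk_mem_pairsIn.2 ⟨hxy, hx, hy⟩

theorem ncard_add_six_le {D : Set (Sym2 V)} (hDi : (rigidityMatroid κ V).Indep D) {X : Set V}
    (hD : D ⊆ pairsIn X) (hX : 3 ≤ X.ncard) : D.ncard + 6 ≤ 3 * X.ncard := by
  have := rk_pairsIn_add_six_le κ X hX
  have := ncard_le_rk hDi hD
  omega

/-- An independent subgraph with 3n - 6 edges has the rank of the complete graph on its vertices and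
would be rigid. -/
theorem NucleationFree.ncard_edgeSet_add_seven_le (hG : NucleationFree κ G)
    (hGi : IsIndependent κ G) (N : G.Subgraph) (hN : 5 ≤ N.verts.ncard) :
    N.edgeSet.ncard + 7 ≤ 3 * N.verts.ncard := by
  by_contra hlt
  refine hG N hN (subset_closure_of_rk_le (fun e he => he.1) (edgeSet_subset_pairsIn N) ?_)
  have := rk_pairsIn_add_six_le κ N.verts (by omega)
  rw [rk_eq_ncard (hGi.subset N.edgeSet_subset)]
  omega

theorem IsRigid.three_mul_ncard_le {N : G.Subgraph} (hN : IsRigid κ N) (h : 3 ≤ N.verts.ncard) :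
    3 * N.verts.ncard ≤ N.edgeSet.ncard + 6 := by
  have h1 := three_mul_ncard_le_rk_pairsIn_add_six κ N.verts h
  have h2 := rk_mono (κ := κ) hN
  have h3 := rk_le_ncard (κ := κ) N.edgeSet
  rw [rk_closure] at h2
  omega

/-- A subgraph of the split graph that contains copies of both `a` and `b` has few edges, because
they are the edges of a subgraph of `G` with fewer vertices. -/
theorem ncard_edgeSet_add_le_of_splitGraph (hG : IsIndependent κ G) {a b : V} (hab : a ≠ b)
    (hGab : ¬ G.Adj a b) {α β : V → Fin 2} (N : (splitGraph G a b α β).Subgraph)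
    (hN : 3 ≤ (N.verts ∩ newVertices a b).ncard) :
    N.edgeSet.ncard + 3 * (N.verts ∩ newVertices a b).ncard ≤ 3 * N.verts.ncard := by
  -- Each of `a` and `b` has only two copies, so three new vertices include copies of both.
  have hcopies : ∀ (v w : V), (∀ x ∈ newVertices a b, collapse x = v ∨ collapse x = w) →
      (collapse ⁻¹' {w} : Set (SplitVertex a b)).ncard ≤ 2 →
      ∃ x ∈ N.verts, collapse x = v := by
    intro v w h hw
    by_contra! hn
    have h1 : N.verts ∩ newVertices a b ⊆ collapse ⁻¹' {w} := fun x hx =>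
      (h x hx.2).resolve_left (hn x hx.1)
    have := Set.ncard_le_ncard h1 (Set.toFinite _)
    omega
  obtain ⟨x, hxN, hxa⟩ := hcopies a b (fun x => mem_newVertices_iff.1)
    (by rw [collapse_preimage_right hab]; exact ncard_pair_le_two _ _)
  obtain ⟨y, hyN, hyb⟩ := hcopies b a (fun x hx => (mem_newVertices_iff.1 hx).symm)
    (by rw [collapse_preimage_left hab]; exact ncard_pair_le_two _ _)
  have haX : a ∈ collapse '' N.verts := ⟨x, hxN, hxa⟩
  have hbX : b ∈ collapse '' N.verts := ⟨y, hyN, hyb⟩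
  set D := Sym2.map collapse '' N.edgeSet with hD
  have hDc : D.ncard = N.edgeSet.ncard :=
    ((injOn_map_collapse hab).mono N.edgeSet_subset).ncard_image
  have hDG : D ⊆ G.edgeSet :=
    (Set.image_mono N.edgeSet_subset).trans image_map_collapse_edgeSet.subset
  have hDX : D ⊆ pairsIn (collapse '' N.verts) := by
    intro e he
    refine ⟨G.not_isDiag_of_mem_edgeSet (hDG he), ?_⟩
    obtain ⟨e, he, rfl⟩ := he
    intro v hv
    obtain ⟨x, hx, rfl⟩ := Sym2.mem_map.1 hv
    exact ⟨x, N.mem_verts_of_mem_edge he hx, rfl⟩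
  have h1 : (collapse '' N.verts).ncard ≤ (N.verts \ newVertices a b).ncard + 2 := by
    have hsub : collapse '' N.verts ⊆ collapse '' (N.verts \ newVertices a b) ∪ {a, b} := by
      rintro _ ⟨x, hx, rfl⟩
      by_cases hxn : x ∈ newVertices a b
      · exact Or.inr (mem_newVertices_iff.1 hxn)
      · exact Or.inl ⟨x, ⟨hx, hxn⟩, rfl⟩
    refine (Set.ncard_le_ncard hsub (Set.toFinite _)).trans ((Set.ncard_union_le _ _).trans ?_)
    exact Nat.add_le_add (Set.ncard_image_le (Set.toFinite _)) (ncard_pair_le_two _ _)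
  have h2 := Set.ncard_inter_add_ncard_sdiff_eq_ncard N.verts (newVertices a b) (Set.toFinite _)
  have h3 : 2 ≤ (collapse '' N.verts).ncard := by
    rw [← Set.ncard_pair hab]
    exact Set.ncard_le_ncard (Set.pair_subset haX hbX) (Set.toFinite _)
  -- The bound 3n - 6 needs three vertices. If only `a` and `b` remain after collapsing, there are
  -- no edges at all because `ab` is a nonedge.
  rcases h3.eq_or_lt with h3 | h3
  · have h4 := ncard_lt_choose hDX hab haX hbX fun h => hGab (hDG h)
    rw [← h3] at h4
    have h5 := Set.ncard_le_ncard (Set.inter_subset_left : N.verts ∩ newVertices a b ⊆ N.verts)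
      (Set.toFinite _)
    simp only [Nat.choose_self] at h4
    omega
  · have h4 := ncard_add_six_le (hG.subset hDG) hDX h3
    omega

end Count

/-! ### Nucleation-freeness of the glued graph -/

theorem ncard_newVertices_le {V : Type*} (a b : V) : (newVertices a b).ncard ≤ 4 := by
  rw [newVertices, ← Set.image_univ]
  refine (Set.ncard_image_le Set.finite_univ).trans ?_
  rw [Set.ncard_univ, Nat.card_eq_fintype_card]
  simp

/-- The gluing argument for nucleation-freeness. -/
theorem IsSafeSplitAndGlue.nucleationFree {κ : RigidityKind} {V U : Type*} [Finite V] [Finite U]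
    {G : SimpleGraph V} {𝒳 : Set (Set V)} {a b : V} {α β : V → Fin 2} {P : Set (SplitVertex a b)}
    {H : SimpleGraph U} {𝒴 : Set (Set U)} {Q : Set U} {φ : Q ≃ P}
    (h : IsSafeSplitAndGlue κ G 𝒳 a b α β P H 𝒴 Q φ)
    (hGsi : IsIndependent κ (splitGraph G a b α β)) (hHi : IsIndependent κ H)
    (hGs : NucleationFree κ (splitGraph G a b α β)) (hH : NucleationFree κ H) :
    NucleationFree κ (glue (splitGraph G a b α β) H φ) := by
  intro N hN hrig
  have hcount := hrig.three_mul_ncard_le (by omega)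
  have hle := ncard_edgeSet_subgraph_glue_le N
  have hverts := ncard_comap_verts_add N
  have hz := ncard_comap_verts_inter N
  set N₁ := N.comap (glueInl (splitGraph G a b α β) H φ) with hN₁
  set N₂ := N.comap (glueInr (splitGraph G a b α β) H φ) with hN₂
  have h1 := hGs.ncard_edgeSet_add_seven_le hGsi N₁
  have h2 := hH.ncard_edgeSet_add_seven_le hHi N₂
  have hz1 := Set.ncard_le_ncard (Set.inter_subset_left : N₁.verts ∩ P ⊆ N₁.verts) (Set.toFinite _)
  have hz2 := Set.ncard_le_ncard (Set.inter_subset_left : N₂.verts ∩ Q ⊆ N₂.verts) (Set.toFinite _)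
  have hz4 : (N₁.verts ∩ P).ncard ≤ 4 :=
    (Set.ncard_le_ncard (Set.inter_subset_right.trans h.gluing_subset) (Set.toFinite _)).trans
      (ncard_newVertices_le a b)
  have hzle : (N₁.verts ∩ P).ncard ≤ (N₁.verts ∩ newVertices a b).ncard :=
    Set.ncard_le_ncard (Set.inter_subset_inter_right _ h.gluing_subset) (Set.toFinite _)
  -- With z ≥ 3 shared vertices the bounds 3n_i - 7 need not suffice. Here the base side has at most
  -- 3n₁ - 3z edges, which cancels the overlap in the vertex count.
  have h3 : 3 ≤ (N₁.verts ∩ P).ncard →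
      N₁.edgeSet.ncard + 3 * (N₁.verts ∩ P).ncard ≤ 3 * N₁.verts.ncard := by
    intro h3
    have := ncard_edgeSet_add_le_of_splitGraph h.base.independent h.split.ne h.split.not_adj N₁
      (h3.trans hzle)
    omega
  have c1 := ncard_le_choose (edgeSet_subset_pairsIn N₁)
  have c2 := ncard_le_choose (edgeSet_subset_pairsIn N₂)
  -- Two shared gluing vertices form a nonedge on both sides, so small parts cannot be complete;
  -- this excludes counts such as two copies of K₄ glued along a pair.
  have d1 : 2 ≤ (N₁.verts ∩ P).ncard → N₁.edgeSet.ncard < N₁.verts.ncard.choose 2 := by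
    intro h4
    obtain ⟨x, y, hx, hy, hxy⟩ := (Set.one_lt_ncard_iff (Set.toFinite _)).1 h4
    exact ncard_lt_choose (edgeSet_subset_pairsIn N₁) hxy hx.1 hy.1 fun he =>
      not_adj_of_mem_newVertices h.split.not_adj (h.gluing_subset hx.2) (h.gluing_subset hy.2)
        (N₁.edgeSet_subset he)
  have d2 : 2 ≤ (N₁.verts ∩ P).ncard → N₂.edgeSet.ncard < N₂.verts.ncard.choose 2 := by
    intro h4
    rw [← hz] at h4
    obtain ⟨x, y, hx, hy, hxy⟩ := (Set.one_lt_ncard_iff (Set.toFinite _)).1 h4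
    exact ncard_lt_choose (edgeSet_subset_pairsIn N₂) hxy hx.1 hy.1 fun he =>
      h.ear.nonedges x hx.2 y hy.2 (N₂.edgeSet_subset he)
  have hchoose : ∀ n : ℕ, (n = 0 → n.choose 2 = 0) ∧ (n = 1 → n.choose 2 = 0) ∧
      (n = 2 → n.choose 2 = 1) ∧ (n = 3 → n.choose 2 = 3) ∧ (n = 4 → n.choose 2 = 6) := by
    intro n
    refine ⟨?_, ?_, ?_, ?_, ?_⟩ <;> rintro rfl <;> rfl
  have e1 := hchoose N₁.verts.ncard
  have e2 := hchoose N₂.verts.ncard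
  generalize N₁.verts.ncard.choose 2 = k₁ at *
  generalize N₂.verts.ncard.choose 2 = k₂ at *
  generalize N₁.verts.ncard = n₁ at *
  generalize N₂.verts.ncard = n₂ at *
  generalize N₁.edgeSet.ncard = m₁ at *
  generalize N₂.edgeSet.ncard = m₂ at *
  generalize (N₁.verts ∩ P).ncard = z at *
  obtain hn1 | hn1 : 5 ≤ n₁ ∨ n₁ ≤ 4 := by omega
  all_goals obtain hn2 | hn2 : 5 ≤ n₂ ∨ n₂ ≤ 4 := by omega
  all_goals interval_cases z <;> omega

/-! ### The implied nonedge -/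

/-- The key gluing pairs of the two graphs become the same pairs in the glued graph. -/
theorem IsSafeSplitAndGlue.image_keyPairs_eq {κ : RigidityKind} {V U : Type*} [Finite V] [Finite U]
    {G : SimpleGraph V} {𝒳 : Set (Set V)} {a b : V} {α β : V → Fin 2} {P : Set (SplitVertex a b)}
    {H : SimpleGraph U} {𝒴 : Set (Set U)} {Q : Set U} {φ : Q ≃ P}
    (h : IsSafeSplitAndGlue κ G 𝒳 a b α β P H 𝒴 Q φ) :
    Sym2.map Sum.inl '' keyPairs (safeSplitCover G 𝒳 a b α β) (newVertices a b) =
      Sym2.map (glueRight φ) '' keyPairs 𝒴 Q := by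
  ext e
  constructor
  · rintro ⟨e, he, rfl⟩
    have hP := h.key_subset e he
    induction e with | _ x y =>
    have hx := hP x (by simp)
    have hy := hP y (by simp)
    obtain ⟨u, hu⟩ := φ.surjective ⟨x, hx⟩
    obtain ⟨v, hv⟩ := φ.surjective ⟨y, hy⟩
    obtain rfl : (φ u : SplitVertex a b) = x := by rw [hu]
    obtain rfl : (φ v : SplitVertex a b) = y := by rw [hv]
    refine ⟨s(u, v), (h.key_iff u v).1 he, ?_⟩
    rw [Sym2.map_mk, Sym2.map_mk, glueRight_of_mem u.2, glueRight_of_mem v.2]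
  · rintro ⟨e, he, rfl⟩
    induction e with | _ u v =>
    obtain ⟨-, hu, hv⟩ := mk_mem_pairsIn.1 he.1
    refine ⟨s((φ ⟨u, hu⟩ : SplitVertex a b), φ ⟨v, hv⟩), (h.key_iff ⟨u, hu⟩ ⟨v, hv⟩).2 he, ?_⟩
    rw [Sym2.map_mk, Sym2.map_mk, glueRight_of_mem hu, glueRight_of_mem hv]

/-- The rank count with respect to the shared and key pairs exceeds the rank of `H` by exactly one,
and it bounds the rank of `H` with all these pairs added. -/
theorem IsSafeEar.rk_union_keyPairs_le {κ : RigidityKind} {U : Type*} [Finite U]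
    {H : SimpleGraph U} {𝒴 : Set (Set U)} {Q : Set U} (h : IsSafeEar κ H 𝒴 Q)
    (hHi : IsIndependent κ H) :
    rk κ (H.edgeSet ∪ keyPairs 𝒴 Q) ≤ H.edgeSet.ncard + 1 := by
  have hS : (rigidityMatroid κ U).Indep (sharedSet 𝒴 ∪ keyPairs 𝒴 Q) :=
    h.union_indep.subset (Set.union_subset_union_right _ (Set.sep_subset _ _))
  have h1 := rk_edgeSet_union_le_rankCount h.cover hS
  have h2 := h.rank_eq
  have h3 : rk κ (H.edgeSet ∪ keyPairs 𝒴 Q) ≤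
      rk κ (H.edgeSet ∪ (sharedSet 𝒴 ∪ keyPairs 𝒴 Q)) :=
    rk_mono (Set.union_subset_union_right _ Set.subset_union_right)
  rw [rk_eq_ncard hHi] at h2
  omega

theorem IsSafeSplitAndGlue.exists_isImpliedNonedge {κ : RigidityKind} {V U : Type*} [Finite V]
    [Finite U] {G : SimpleGraph V} {𝒳 : Set (Set V)} {a b : V} {α β : V → Fin 2}
    {P : Set (SplitVertex a b)} {H : SimpleGraph U} {𝒴 : Set (Set U)} {Q : Set U} {φ : Q ≃ P}
    (h : IsSafeSplitAndGlue κ G 𝒳 a b α β P H 𝒴 Q φ)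
    (hind : IsIndependent κ (glue (splitGraph G a b α β) H φ))
    (hGsi : IsIndependent κ (splitGraph G a b α β)) (hHi : IsIndependent κ H) :
    ∃ f, IsImpliedNonedge κ (glue (splitGraph G a b α β) H φ) f := by
  have hA := h.base.rk_splitGraph_union_keyPairs h.split hGsi
  have hB := h.ear.rk_union_keyPairs_le hHi
  have hFF := h.image_keyPairs_eq
  have hFi : (rigidityMatroid κ U).Indep (keyPairs 𝒴 Q) :=
    h.ear.union_indep.subset ((Set.sep_subset _ _).trans Set.subset_union_right)
  have hdisj := disjoint_edgeSet_glue (G := splitGraph G a b α β) h.ear.nonedges φ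
  have hinl : Function.Injective
      (Sum.inl : SplitVertex a b → SplitVertex a b ⊕ {u : U // u ∉ Q}) := Sum.inl_injective
  have hinr := glueRight_injective φ
  set K := keyPairs (safeSplitCover G 𝒳 a b α β) (newVertices a b) with hK
  set F := Sym2.map (glueRight φ) '' keyPairs 𝒴 Q with hF
  set E := (glue (splitGraph G a b α β) H φ).edgeSet with hE
  have hEeq : E = Sym2.map Sum.inl '' (splitGraph G a b α β).edgeSet ∪
      Sym2.map (glueRight φ) '' H.edgeSet := edgeSet_glue φ
  have hEcard : E.ncard = (splitGraph G a b α β).edgeSet.ncard + H.edgeSet.ncard := by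
    rw [hEeq, Set.ncard_union_eq hdisj, Set.ncard_image_of_injective _ (Sym2.map.injective hinl),
      Set.ncard_image_of_injective _ (Sym2.map.injective hinr)]
  have hFrk : rk κ F = K.ncard := by
    rw [hF, rk_image_map hinr, rk_eq_ncard hFi,
      ← Set.ncard_image_of_injective _ (Sym2.map.injective hinr), ← hF, ← hFF,
      Set.ncard_image_of_injective _ (Sym2.map.injective hinl)]
  rw [← rk_image_map hinl, Set.image_union, hFF] at hA
  rw [← rk_image_map hinr, Set.image_union, ← hF] at hB
  have hsub := rk_inter_add_rk_union_le (κ := κ)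
    (Sym2.map Sum.inl '' (splitGraph G a b α β).edgeSet ∪ F)
    (Sym2.map (glueRight φ) '' H.edgeSet ∪ F)
  have hle : rk κ F ≤ rk κ ((Sym2.map Sum.inl '' (splitGraph G a b α β).edgeSet ∪ F) ∩
      (Sym2.map (glueRight φ) '' H.edgeSet ∪ F)) :=
    rk_mono (Set.subset_inter Set.subset_union_right Set.subset_union_right)
  rw [← Set.union_union_distrib_right, ← hEeq] at hsub
  -- The deficit of one on the base side cancels the surplus of one on the ear side.
  have hrk : rk κ (E ∪ F) ≤ rk κ E := by
    rw [rk_eq_ncard hind, hEcard]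
    omega
  -- Without key pairs the base bound would say that the rank of the independent split graph is less
  -- than its number of edges.
  have hFne : K.Nonempty := by
    rw [Set.nonempty_iff_ne_empty]
    intro h0
    rw [← hFF, h0, Set.image_empty, Set.union_empty, rk_image_map hinl, rk_eq_ncard hGsi,
      Set.ncard_empty] at hA
    omega
  obtain ⟨f, hf⟩ := hFne
  have hfF : Sym2.map Sum.inl f ∈ F := hFF ▸ Set.mem_image_of_mem _ hf
  have hdiag : ∀ e ∈ E ∪ F, ¬ e.IsDiag := by
    rintro e (he | ⟨e, he, rfl⟩)
    · exact hind.subset_ground he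
    · rw [isDiag_map_iff hinr]
      exact he.1.1
  have hcl := subset_closure_of_rk_le hdiag Set.subset_union_left hrk (Or.inr hfF)
  have hnE : Sym2.map Sum.inl f ∉ E := by
    rw [hEeq]
    rintro (⟨e, he, hef⟩ | ⟨e, he, hef⟩)
    · obtain rfl := Sym2.map.injective hinl hef
      induction e with | _ x y =>
      obtain ⟨-, hx, hy⟩ := mk_mem_pairsIn.1 hf.1
      exact not_adj_of_mem_newVertices h.split.not_adj hx hy he
    · obtain ⟨e', he', hef'⟩ := hfF
      obtain rfl := Sym2.map.injective hinr (hef.trans hef'.symm)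
      induction e with | _ x y =>
      obtain ⟨-, hx, hy⟩ := mk_mem_pairsIn.1 he'.1
      exact h.ear.nonedges x hx y hy he
  obtain ⟨C, hCE, hC, hfC⟩ := Matroid.exists_isCircuit_of_mem_closure hcl hnE
  exact ⟨_, hdiag _ (Or.inr hfF), hnE, C, hC, hCE, hfC⟩

end SplitGlue

open SplitGlue
theorem corollary3p8 (κ : RigidityKind) {V U : Type*} [Finite V] [Finite U]
    (G : SimpleGraph V) (𝒳 : Set (Set V)) (a b : V) (α β : V → Fin 2) (P : Set (SplitVertex a b))
    (H : SimpleGraph U) (𝒴 : Set (Set U)) (Q : Set U) (φ : Q ≃ P)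
    (hsafe : IsSafeSplitAndGlue κ G 𝒳 a b α β P H 𝒴 Q φ)
    (hind : IsIndependent κ (glue (splitGraph G a b α β) H φ))
    (hGs : NucleationFree κ (splitGraph G a b α β))
    (hH : NucleationFree κ H) :
    NucleationFree κ (glue (splitGraph G a b α β) H φ) ∧
      ∃ f, IsImpliedNonedge κ (glue (splitGraph G a b α β) H φ) f := by
  have hE := edgeSet_glue (G := splitGraph G a b α β) (H := H) φ
  -- Independence of the two sides is not assumed: both edge sets embed into the independent edge
  -- set of the glued graph.
  have hGsi : IsIndependent κ (splitGraph G a b α β) :=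
    (indep_image_map_iff Sum.inl_injective).1 (hind.subset (hE ▸ Set.subset_union_left))
  have hHi : IsIndependent κ H :=
    (indep_image_map_iff (glueRight_injective φ)).1 (hind.subset (hE ▸ Set.subset_union_right))
  exact ⟨hsafe.nucleationFree hGsi hHi hGs hH, hsafe.exists_isImpliedNonedge hind hGsi hHi⟩
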